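/- Let $n,p\ge 0$ be integers. For $z\in\mathbb C$ and an integer $k\ge 0$ put $(z)_k=z(z+1)\cdots(z+k-1)$ and $(z)_{-k}=\frac1{(z-1)(z-2)\cdots(z-k)}$, so that $(z)_\nu=\Gamma(z+\nu)/\Gamma(z)$ whenever this quotient exists. For multi-indices put $|m|=m_1+\dots+m_n$. Let $a\in\mathbb C\setminus\{1,2,3,\dots\}$, $b\in\mathbb C^n$, and $c\in\mathbb C^n$ with no $c_i\in\{0,-1,-2,\dots\}$. For $x\in\mathbb C^n$ with $|x_1|+\dots+|x_n|<1$ and $y\in\mathbb C^p$ let $$F_A^{(n)}(a,b;c;x)=\sum_{m\in\mathbb N_0^n}(a)_{|m|}\prod_{i=1}^n\frac{(b_i)_{m_i}}{(c_i)_{m_i}}\frac{x_i^{m_i}}{m_i!},\qquad {}_0F_p(d;y)=\sum_{q\in\mathbb N_0^p}\frac1{(d)_{|q|}}\prod_{j=1}^p\frac{y_j^{q_j}}{q_j!},$$ $$\mathrm H_A^{(n,p)}(a,b;c;x,y)=\sum_{m\in\mathbb N_0^n,\ q\in\mathbb N_0^p}(a)_{|m|-|q|}\prod_{i=1}^n\frac{(b_i)_{m_i}}{(c_i)_{m_i}}\frac{x_i^{m_i}}{m_i!}\prod_{j=1}^p\frac{y_j^{q_j}}{q_j!}.$$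 For $p=1$, ${}_0F_1(d;y)=\sum_{q\ge0}\frac{y^q}{(d)_q\,q!}$. The series for $\mathrm H_A^{(n,p)}(a,b;c;x,y)$, for $F_A^{(n)}(a+|i|,b+i;c+i;x)$ $(i\in\mathbb N_0^n)$, for ${}_0F_p(1-a+l;-y)$ $(l\ge0)$, and for ${}_0F_1(1-a+l;-y_1)$ $(l\ge 0)$ when $p=1$, converge absolutely. Let $\delta_i=x_i\,\partial/\partial x_i$, $\sigma_j=y_j\,\partial/\partial y_j$, and let $$\tilde\nabla^{(n,p)}_{x,y}(h)=\frac{\Gamma(h)\,\Gamma(h+\delta_1+\dots+\delta_n-\sigma_1-\dots-\sigma_p)}{\Gamma(h+\delta_1+\dots+\delta_n)\,\Gamma(h-\sigma_1-\dots-\sigma_p)}$$ be the operator acting on power series in $(x,y)$ that multiplies each monomial $x^my^q$ by $\frac{\Gamma(h)\Gamma(h+|m|-|q|)}{\Gamma(h+|m|)\Gamma(h-|q|)}$. Then the following hold. 1. If $a\notin\mathbb Z$, then for all $x$ with $\sum_i|x_i|<1$ and all $y$ $$\mathrm H_A^{(n,p)}(a,b;c;x,y)=\tilde\nabla^{(n,p)}_{x,y}(a)\,F_A^{(n)}(a,b;c;x)\,{}_0F_p(1-a;-y).$$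 If moreover $\sum_{i=1}^n\max(\operatorname{Re}x_i,0)<\frac12$, then, with the operator series evaluated at $(x,y)$ and converging absolutely, $$\mathrm H_A^{(n,p)}(a,b;c;x,y)=\sum_{k=0}^\infty\frac{(-\delta_1-\dots-\delta_n)_k(\sigma_1+\dots+\sigma_p)_k}{(a)_k\,k!}\Bigl[F_A^{(n)}(a,b;c;x)\,{}_0F_p(1-a;-y)\Bigr].$$ 2. For all $x$ with $\sum_i|x_i|<1$ and $\sum_{i=1}^n\max(\operatorname{Re}x_i,0)<\frac12$, and all $y$, $$\mathrm H_A^{(n,p)}(a,b;c;x,y)=F_A^{(n)}(a,b;c;x)\,{}_0F_p(1-a;-y)$$ $$+\sum_{k=1}^\infty\ \sum_{l=1}^k\ \sum_{\substack{i\in\mathbb N_0^n,\ j\in\mathbb N_0^p\\ |i|=k,\ |j|=l}}\binom{k-1}{l-1}\frac{(-1)^{k+l}\,k!\,\prod_{s=1}^n(b_s)_{i_s}}{(1-a)_l\,\prod_{s=1}^n(c_s)_{i_s}}\ \prod_{s=1}^n\frac{x_s^{i_s}}{i_s!}\ \prod_{t=1}^p\frac{y_t^{j_t}}{j_t!}\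 F_A^{(n)}(a+k,b+i;c+i;x)\ {}_0F_p(1-a+l;-y),$$ where the outer series over $k$ (of the finite inner sums) converges absolutely. 3. For $p=1$ and the same $x$, and all $y_1\in\mathbb C$, $$\mathrm H_A^{(n,1)}(a,b;c;x,y_1)=F_A^{(n)}(a,b;c;x)\,{}_0F_1(1-a;-y_1)$$ $$+\sum_{k=1}^\infty\ \sum_{l=1}^k\ \sum_{\substack{i\in\mathbb N_0^n\\ |i|=k}}\binom{k-1}{l-1}\frac{(-1)^{k+l}\,k!\,\prod_{s=1}^n(b_s)_{i_s}}{(1-a)_l\,\prod_{s=1}^n(c_s)_{i_s}}\ \prod_{s=1}^n\frac{x_s^{i_s}}{i_s!}\ \frac{y_1^l}{l!}\ F_A^{(n)}(a+k,b+i;c+i;x)\ {}_0F_1(1-a+l;-y_1),$$ where the outer series over $k$ converges absolutely. -/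

import Mathlib

open Finset

noncomputable section

/-- The shifted factorial `(z)_k = z (z + 1) ⋯ (z + k - 1)`, with `(z)_0 = 1`. -/
def poch (z : ℂ) (k : ℕ) : ℂ := ∏ r ∈ range k, (z + r)

/-- The shifted factorial `(z)_ν` for an integer `ν`:
`(z)_k = z (z + 1) ⋯ (z + k - 1)` and `(z)_{-k} = 1 / ((z - 1) (z - 2) ⋯ (z - k))`, `k ≥ 0`. -/
def pochZ (z : ℂ) (ν : ℤ) : ℂ :=
  if 0 ≤ ν then poch z ν.toNat else (∏ r ∈ range (-ν).toNat, (z - (r + 1)))⁻¹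

/-- The general term of the Lauricella series `F_A^{(n)}(a, b; c; x)`. -/
def lauricellaATerm {n : ℕ} (a : ℂ) (b c x : Fin n → ℂ) (m : Fin n → ℕ) : ℂ :=
  poch a (∑ i, m i) * ∏ i, (poch (b i) (m i) / (poch (c i) (m i) * (m i).factorial) * x i ^ m i)

/-- The Lauricella function `F_A^{(n)}(a, b; c; x)`. -/
def lauricellaA {n : ℕ} (a : ℂ) (b c x : Fin n → ℂ) : ℂ :=
  ∑' m : Fin n → ℕ, lauricellaATerm a b c x m

/-- The general term of `H_A^{(n,p)}(a, b; c; x, y)`, at `(m_1, …, m_n)` and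
`(m_{n+1}, …, m_{n+p}) = (q_1, …, q_p)`. -/
def confluentHATerm {n p : ℕ} (a : ℂ) (b c x : Fin n → ℂ) (y : Fin p → ℂ)
    (mq : (Fin n → ℕ) × (Fin p → ℕ)) : ℂ :=
  pochZ a ((∑ i, (mq.1 i : ℤ)) - ∑ j, (mq.2 j : ℤ)) *
    (∏ i, (poch (b i) (mq.1 i) / (poch (c i) (mq.1 i) * (mq.1 i).factorial) * x i ^ mq.1 i)) *
    ∏ j, (y j ^ mq.2 j / (mq.2 j).factorial)

/-- The confluent hypergeometric function `H_A^{(n,p)}(a, b; c; x, y)` of `n + p` variables. -/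
def confluentHA {n p : ℕ} (a : ℂ) (b c x : Fin n → ℂ) (y : Fin p → ℂ) : ℂ :=
  ∑' mq : (Fin n → ℕ) × (Fin p → ℕ), confluentHATerm a b c x y mq

/-- The general term of the `p`-variable function `₀F_p(d; y)`. -/
def zeroFTerm {p : ℕ} (d : ℂ) (y : Fin p → ℂ) (q : Fin p → ℕ) : ℂ :=
  (poch d (∑ j, q j))⁻¹ * ∏ j, (y j ^ q j / (q j).factorial)

/-- `₀F_p(d; y) = ∑ y_1^{q_1} ⋯ y_p^{q_p} / ((d)_{q_1 + ⋯ + q_p} q_1! ⋯ q_p!)`. -/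
def zeroF {p : ℕ} (d : ℂ) (y : Fin p → ℂ) : ℂ := ∑' q : Fin p → ℕ, zeroFTerm d y q

/-- The general term of the one-variable function `₀F₁(d; z)`. -/
def zeroF1Term (d z : ℂ) (q : ℕ) : ℂ := z ^ q / (poch d q * q.factorial)

/-- `₀F₁(d; z) = ∑ z^q / ((d)_q q!)`. -/
def zeroF1 (d z : ℂ) : ℂ := ∑' q : ℕ, zeroF1Term d z q

/-- `δ_1 + ⋯ + δ_n`, where `δ_i = x_i ∂/∂x_i`. -/
def eulerX {n p : ℕ} (f : (Fin n → ℂ) → (Fin p → ℂ) → ℂ) (x : Fin n → ℂ) (y : Fin p → ℂ) : ℂ :=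
  ∑ i, x i * deriv (fun t => f (Function.update x i t) y) (x i)

/-- `σ_1 + ⋯ + σ_p`, where `σ_j = y_j ∂/∂y_j`. -/
def eulerY {n p : ℕ} (f : (Fin n → ℂ) → (Fin p → ℂ) → ℂ) (x : Fin n → ℂ) (y : Fin p → ℂ) : ℂ :=
  ∑ j, y j * deriv (fun t => f x (Function.update y j t)) (y j)

/-- The shifted factorial `(T)_k = T (T + 1) ⋯ (T + k - 1)` of an operator `T` on functions. -/
def opPoch {n p : ℕ}
    (T : ((Fin n → ℂ) → (Fin p → ℂ) → ℂ) → (Fin n → ℂ) → (Fin p → ℂ) → ℂ) :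
    ℕ → ((Fin n → ℂ) → (Fin p → ℂ) → ℂ) → (Fin n → ℂ) → (Fin p → ℂ) → ℂ
  | 0, f => f
  | k + 1, f => fun x y => T (opPoch T k f) x y + k * opPoch T k f x y

/-- The `k`-th term `(-δ_1 - ⋯ - δ_n)_k (σ_1 + ⋯ + σ_p)_k f / ((h)_k k!)` of the operator series of
`∇̃^{(n,p)}_{x,y}(h)` applied to `f`. -/
def nablaSeriesTerm {n p : ℕ} (h : ℂ) (k : ℕ) (f : (Fin n → ℂ) → (Fin p → ℂ) → ℂ)
    (x : Fin n → ℂ) (y : Fin p → ℂ) : ℂ :=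
  opPoch (fun g x y => -eulerX g x y) k (opPoch eulerY k f) x y / (poch h k * k.factorial)

/-- The symbol `Γ(h) Γ(h + M - N) / (Γ(h + M) Γ(h - N))` of `∇̃^{(n,p)}_{x,y}(h)`. -/
def nablaSymbol (h : ℂ) (M N : ℕ) : ℂ :=
  Complex.Gamma h * Complex.Gamma (h + M - N) / (Complex.Gamma (h + M) * Complex.Gamma (h - N))

/-- `g = ∇̃^{(n,p)}_{x,y}(h) f` on `D`, where `∇̃^{(n,p)}_{x,y}(h)` is the operator
`Γ(h) Γ(h + δ_1 + ⋯ + δ_n - σ_1 - ⋯ - σ_p) / (Γ(h + δ_1 + ⋯ + δ_n) Γ(h - σ_1 - ⋯ - σ_p))`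
acting on functions with a power series: a monomial `x^m y^q` is an eigenvector of every `δ_i` and
`σ_j`, with the eigenvalues `m_i` and `q_j`, hence of the operator, with the eigenvalue
`nablaSymbol h (m_1 + ⋯ + m_n) (q_1 + ⋯ + q_p)`. -/
def IsNablaImage {n p : ℕ} (h : ℂ) (D : Set ((Fin n → ℂ) × (Fin p → ℂ)))
    (f g : (Fin n → ℂ) → (Fin p → ℂ) → ℂ) : Prop :=
  ∃ A : (Fin n → ℕ) × (Fin p → ℕ) → ℂ, ∀ z ∈ D,
    HasSum (fun mq => A mq * ((∏ i, z.1 i ^ mq.1 i) * ∏ j, z.2 j ^ mq.2 j)) (f z.1 z.2) ∧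
    HasSum (fun mq => nablaSymbol h (∑ i, mq.1 i) (∑ j, mq.2 j) * A mq *
      ((∏ i, z.1 i ^ mq.1 i) * ∏ j, z.2 j ^ mq.2 j)) (g z.1 z.2)

/-- The `k`-th term (`k ≥ 1`) of the decomposition of `H_A^{(n,p)}(a, b; c; x, y)`; it is a finite
sum over `1 ≤ l ≤ k` and the multi-indices `i`, `j` with `|i| = k`, `|j| = l`. -/
def decompTerm {n p : ℕ} (a : ℂ) (b c x : Fin n → ℂ) (y : Fin p → ℂ) (k : ℕ) : ℂ :=
  ∑ l ∈ Icc 1 k, ∑ i ∈ piAntidiag (univ : Finset (Fin n)) k,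
    ∑ j ∈ piAntidiag (univ : Finset (Fin p)) l,
      ((k - 1).choose (l - 1) : ℂ) *
        ((-1) ^ (k + l) * k.factorial * (∏ s, poch (b s) (i s)) /
          (poch (1 - a) l * ∏ s, poch (c s) (i s))) *
        (∏ s, (x s ^ i s / (i s).factorial)) * (∏ t, (y t ^ j t / (j t).factorial)) *
        lauricellaA (a + k) (fun s => b s + i s) (fun s => c s + i s) x *
        zeroF (1 - a + l) (-y)

/-- The `k`-th term (`k ≥ 1`) of the decomposition of `H_A^{(n,1)}(a, b; c; x, y)`. -/
def decompTermOne {n : ℕ} (a : ℂ) (b c x : Fin n → ℂ) (y : ℂ) (k : ℕ) : ℂ :=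
  ∑ l ∈ Icc 1 k, ∑ i ∈ piAntidiag (univ : Finset (Fin n)) k,
      ((k - 1).choose (l - 1) : ℂ) *
        ((-1) ^ (k + l) * k.factorial * (∏ s, poch (b s) (i s)) /
          (poch (1 - a) l * ∏ s, poch (c s) (i s))) *
        (∏ s, (x s ^ i s / (i s).factorial)) * (y ^ l / l.factorial) *
        lauricellaA (a + k) (fun s => b s + i s) (fun s => c s + i s) x *
        zeroF1 (1 - a + l) (-y)

/-- `(z)_k = Γ(z + k) / Γ(z)` where the quotient exists. -/
theorem poch_eq_Gamma (z : ℂ) (k : ℕ) (hz : ∀ m : ℕ, z ≠ -m) :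
    poch z k = Complex.Gamma (z + k) / Complex.Gamma z := by
  induction k with
  | zero => simp [poch, Complex.Gamma_ne_zero hz]
  | succ k ih =>
    have h : z + k ≠ 0 := fun h => hz k (eq_neg_of_add_eq_zero_left h)
    have e : z + ((k + 1 : ℕ) : ℂ) = z + k + 1 := by push_cast; ring
    rw [poch, prod_range_succ, e, Complex.Gamma_add_one _ h]
    rw [poch] at ih
    rw [ih]; ring

/-- `(z)_ν = Γ(z + ν) / Γ(z)` where the quotient exists. -/
theorem pochZ_eq_Gamma (z : ℂ) (ν : ℤ) (hz : ∀ m : ℤ, z ≠ m) :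
    pochZ z ν = Complex.Gamma (z + ν) / Complex.Gamma z := by
  have hz' : ∀ m : ℕ, z ≠ -m := fun m h => hz (-m) (by rw [h]; push_cast; ring)
  unfold pochZ
  split_ifs with h
  · obtain ⟨k, rfl⟩ := Int.eq_ofNat_of_zero_le h
    simpa using poch_eq_Gamma z k hz'
  · obtain ⟨k, hk⟩ := Int.eq_ofNat_of_zero_le (show 0 ≤ -ν by omega)
    obtain rfl : ν = -(k : ℤ) := by omega
    have key : ∀ k : ℕ, Complex.Gamma z =
        (∏ r ∈ range k, (z - (r + 1))) * Complex.Gamma (z - k) := by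
      intro k
      induction k with
      | zero => simp
      | succ k ih =>
        have h1 : z - ((k + 1 : ℕ) : ℂ) ≠ 0 := fun h => hz (k + 1 : ℕ) (by
          rw [sub_eq_zero.mp h]; push_cast; ring)
        have h2 := Complex.Gamma_add_one _ h1
        have e : z - ((k + 1 : ℕ) : ℂ) + 1 = z - k := by push_cast; ring
        rw [e] at h2
        rw [ih, h2, prod_range_succ]; push_cast; ring
    have hG : Complex.Gamma (z - k) ≠ 0 := Complex.Gamma_ne_zero fun m h =>
      hz (k - m) (by rw [eq_add_of_sub_eq h]; push_cast; ring)
    have e : z + ((-(k : ℤ) : ℤ) : ℂ) = z - k := by push_cast; ring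
    rw [e, key k, neg_neg, Int.toNat_natCast]
    rw [div_mul_cancel_right₀ hG]

end

/-!
The function `z ↦ F_A(z, b; c; x)` turns the whole theorem into Newton's backward difference
formula. Splitting off the indices `q` gives
`H_A(a, b; c; x, y) = ∑_q F_A(a - |q|, b; c; x) ∏_j (-y_j)^{q_j} / q_j! / (1 - a)_{|q|}`,
and Newton's formula reads `F (a - N) = ∑_k (-1)^k (N)_k / k! Δ^k F (a)`. To interchange the two
sums one needs `|Δ^k F (a)| ≤ C θ^k` for some `θ < 1`. If all `b_i` and `c_i - b_i` have positive
real part, Euler's integral writes `F_A` as an average of `(1 - X)^{-z}` with `X = ∑ u_i x_i` over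
the cube, and a difference in `z` multiplies the integrand by `X / (1 - X)`, which has modulus less
than `1` exactly when `Re X < 1/2`; this is the hypothesis on `∑ max (Re x_i) 0`. Contiguous
relations shifting `b_i` and `c_i` carry the bound over to all parameters.

Expanding `Δ^k F_A` in functions `F_A(a + k, b + i; c + i; x)` and, by Vandermonde's identity, the
sum over `q` in functions `₀F_p(1 - a + l; -y)` gives the decomposition. The Euler operators act
diagonally on monomials, and the `k`-th term of the operator series is the `k`-th Newton term, since
`(-M)_k (a)_M = (-1)^k (a)_k Δ^k (a)_M`.
-/

open Filter Asymptotics Topology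
open Function (update)

/-! ### Shifted factorials -/

theorem poch_zero (z : ℂ) : poch z 0 = 1 := prod_range_zero _

theorem poch_succ (z : ℂ) (k : ℕ) : poch z (k + 1) = poch z k * (z + k) := prod_range_succ _ _

theorem poch_add (z : ℂ) (j k : ℕ) : poch z (j + k) = poch z j * poch (z + j) k := by
  simp only [poch, prod_range_add, Nat.cast_add, add_assoc]

theorem poch_succ' (z : ℂ) (k : ℕ) : poch z (k + 1) = z * poch (z + 1) k := by
  rw [add_comm k 1, poch_add]; simp [poch]

theorem poch_ne_zero {z : ℂ} (hz : ∀ m : ℕ, z ≠ -m) (k : ℕ) : poch z k ≠ 0 :=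
  prod_ne_zero_iff.mpr fun r _ h => hz r (eq_neg_of_add_eq_zero_left h)

theorem poch_one (k : ℕ) : poch 1 k = k.factorial := by
  induction k with
  | zero => simp [poch]
  | succ k ih => rw [poch_succ, ih, Nat.factorial_succ]; push_cast; ring

theorem poch_natCast (Q k : ℕ) : poch Q k = k.factorial * Q.multichoose k := by
  rw [Nat.multichoose_eq, ← Nat.cast_mul, ← Nat.ascFactorial_eq_factorial_mul_choose',
    Nat.ascFactorial_eq_prod_range, poch]
  push_cast
  rfl

theorem poch_sub_natCast (a : ℂ) (N : ℕ) : poch (a - N) N = (-1) ^ N * poch (1 - a) N := by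
  induction N with
  | zero => simp [poch]
  | succ N ih =>
    rw [poch_succ', poch_succ, pow_succ,
      show a - ((N + 1 : ℕ) : ℂ) + 1 = a - N by push_cast; ring, ih]
    push_cast
    ring

theorem add_natCast_ne_neg_natCast {z : ℂ} (hz : ∀ m : ℕ, z ≠ -m) (k m : ℕ) : z + k ≠ -m :=
  fun h => hz (k + m) (by rw [eq_sub_of_add_eq h]; push_cast; ring)

theorem one_sub_ne_neg_natCast {a : ℂ} (ha : ∀ m : ℕ, a ≠ m + 1) (m : ℕ) : 1 - a ≠ -m :=
  fun h => ha m (by linear_combination -h)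

theorem poch_sub_natCast_ne_zero {a : ℂ} (ha : ∀ m : ℕ, a ≠ m + 1) {M N : ℕ} (hMN : M ≤ N) :
    poch (a - N) M ≠ 0 := by
  refine prod_ne_zero_iff.mpr fun r hr h => ha (N - r - 1) ?_
  obtain ⟨j, rfl⟩ := Nat.exists_eq_add_of_lt ((mem_range.mp hr).trans_le hMN)
  have hj : r + j + 1 - r - 1 = j := by omega
  rw [hj]
  push_cast at h
  linear_combination h

theorem pochZ_natCast (a : ℂ) (k : ℕ) : pochZ a k = poch a k := by
  rw [pochZ, if_pos (Int.natCast_nonneg k), Int.toNat_natCast]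

theorem pochZ_neg_natCast (a : ℂ) (k : ℕ) : pochZ a (-k) = (poch (a - k) k)⁻¹ := by
  have hprod : ∏ r ∈ range k, (a - (r + 1)) = poch (a - k) k := by
    induction k with
    | zero => rfl
    | succ k ih =>
      rw [prod_range_succ, ih, poch_succ',
        show a - ((k + 1 : ℕ) : ℂ) + 1 = a - k by push_cast; ring]
      push_cast
      ring
  rcases k.eq_zero_or_pos with rfl | hk
  · simp [pochZ, poch_zero]
  · rw [pochZ, if_neg (by omega), neg_neg, Int.toNat_natCast, hprod]

theorem pochZ_sub {a : ℂ} (ha : ∀ m : ℕ, a ≠ m + 1) (M N : ℕ) :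
    pochZ a ((M : ℤ) - N) = poch (a - N) M / poch (a - N) N := by
  rcases le_total N M with h | h
  · obtain ⟨j, rfl⟩ := Nat.exists_eq_add_of_le h
    have hj : ((N + j : ℕ) : ℤ) - N = j := by push_cast; ring
    rw [hj, pochZ_natCast, poch_add, sub_add_cancel,
      mul_div_cancel_left₀ _ (poch_sub_natCast_ne_zero ha le_rfl)]
  · obtain ⟨j, rfl⟩ := Nat.exists_eq_add_of_le h
    have hj : (M : ℤ) - (M + j : ℕ) = -j := by push_cast; ring
    have hshift : a - (M + j : ℕ) + M = a - j := by push_cast; ring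
    rw [hj, pochZ_neg_natCast, poch_add, hshift,
      div_mul_cancel_left₀ (poch_sub_natCast_ne_zero ha h)]

/-! ### Growth of the shifted factorials -/

theorem exists_le_mul_pow_of_succ_le {u : ℕ → ℝ} (hu : ∀ m, 0 ≤ u m) {η : ℝ} (hη : 1 ≤ η) {N : ℕ}
    (h : ∀ m, N ≤ m → u (m + 1) ≤ η * u m) : ∃ C, 0 ≤ C ∧ ∀ m, u m ≤ C * η ^ m := by
  have h0 : 0 ≤ ∑ i ∈ range (N + 1), u i := sum_nonneg fun i _ => hu i
  refine ⟨∑ i ∈ range (N + 1), u i, h0, fun m => ?_⟩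
  have small : ∀ m ≤ N, u m ≤ (∑ i ∈ range (N + 1), u i) * η ^ m := fun m hm =>
    (single_le_sum (f := u) (fun i _ => hu i) (mem_range.mpr (by omega))).trans
      (le_mul_of_one_le_right h0 (one_le_pow₀ hη))
  rcases le_total m N with hm | hm
  · exact small m hm
  · induction m, hm using Nat.le_induction with
    | base => exact small N le_rfl
    | succ m hm ih =>
      calc u (m + 1) ≤ η * u m := h m hm
        _ ≤ η * ((∑ i ∈ range (N + 1), u i) * η ^ m) := by gcongr
        _ = _ := by ring

theorem exists_norm_poch_div_poch_le (b : ℂ) {c : ℂ} (hc : ∀ m : ℕ, c ≠ -m) {η : ℝ}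
    (hη : 1 < η) : ∃ C, 0 ≤ C ∧ ∀ m, ‖poch b m / poch c m‖ ≤ C * η ^ m := by
  obtain ⟨N, hN⟩ := exists_nat_ge ((‖b‖ + η * ‖c‖) / (η - 1))
  refine exists_le_mul_pow_of_succ_le (fun m => norm_nonneg _) hη.le (N := N) fun m hm => ?_
  have hlarge : ‖b‖ + η * ‖c‖ ≤ m * (η - 1) := by
    rw [div_le_iff₀ (by linarith)] at hN
    exact hN.trans (mul_le_mul_of_nonneg_right (by exact_mod_cast hm) (by linarith))
  have hb : ‖b + m‖ ≤ ‖b‖ + m := by simpa using norm_add_le b (m : ℂ)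
  have hcm : (m : ℝ) - ‖c‖ ≤ ‖c + m‖ := by
    have := norm_sub_le (c + m) c
    simp only [add_sub_cancel_left, Complex.norm_natCast] at this
    linarith
  have hpos : 0 < ‖c + m‖ := norm_pos_iff.mpr fun h => hc m (eq_neg_of_add_eq_zero_left h)
  rw [poch_succ, poch_succ, mul_div_mul_comm, norm_mul, mul_comm]
  gcongr
  rw [norm_div, div_le_iff₀ hpos]
  nlinarith

theorem one_ne_neg_natCast (m : ℕ) : (1 : ℂ) ≠ -m := by
  rw [Ne, eq_neg_iff_add_eq_zero]
  exact_mod_cast (by omega : 1 + m ≠ 0)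

theorem exists_norm_poch_le (a : ℂ) {η : ℝ} (hη : 1 < η) :
    ∃ C, 0 ≤ C ∧ ∀ m : ℕ, ‖poch a m‖ ≤ C * η ^ m * m.factorial := by
  obtain ⟨C, hC, h⟩ := exists_norm_poch_div_poch_le a one_ne_neg_natCast hη
  refine ⟨C, hC, fun m => ?_⟩
  have := h m
  rwa [poch_one, norm_div, Complex.norm_natCast, div_le_iff₀ (by positivity)] at this

theorem exists_norm_inv_poch_le {d : ℂ} (hd : ∀ m : ℕ, d ≠ -m) {η : ℝ} (hη : 1 < η) :
    ∃ C, 0 ≤ C ∧ ∀ m : ℕ, ‖(poch d m)⁻¹‖ ≤ C * η ^ m / m.factorial := by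
  obtain ⟨C, hC, h⟩ := exists_norm_poch_div_poch_le 1 hd hη
  refine ⟨C, hC, fun m => ?_⟩
  have := h m
  rw [poch_one, div_eq_mul_inv, norm_mul, Complex.norm_natCast] at this
  rwa [le_div_iff₀' (by positivity)]

theorem exists_norm_poch_sub_natCast_le (a : ℂ) {η : ℝ} (hη : 1 < η) :
    ∃ C, 0 ≤ C ∧ ∀ N M : ℕ, ‖poch (a - N) M‖ ≤ C * 2 ^ N * η ^ M * M.factorial := by
  obtain ⟨C, hC, h⟩ := exists_norm_poch_le a hη
  refine ⟨C, hC, fun N => ?_⟩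
  induction N with
  | zero => simpa using h
  | succ N ih =>
    rintro (_ | M)
    · refine (ih 0).trans ?_
      gcongr <;> simp
    · have hrec : poch (a - (N + 1 : ℕ)) (M + 1)
          = poch (a - N) (M + 1) - (M + 1 : ℕ) * poch (a - N) M := by
        rw [poch_succ', poch_succ, show a - ((N + 1 : ℕ) : ℂ) + 1 = a - N by push_cast; ring]
        push_cast
        ring
      calc ‖poch (a - (N + 1 : ℕ)) (M + 1)‖
          ≤ ‖poch (a - N) (M + 1)‖ + (M + 1 : ℕ) * ‖poch (a - N) M‖ := by
            rw [hrec, ← Complex.norm_natCast, ← norm_mul]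
            exact norm_sub_le _ _
        _ ≤ C * 2 ^ N * η ^ (M + 1) * (M + 1).factorial
            + (M + 1 : ℕ) * (C * 2 ^ N * η ^ (M + 1) * M.factorial) := by
            have hM := ih M
            have hηM : η ^ M ≤ η ^ (M + 1) := pow_le_pow_right₀ hη.le (Nat.le_succ M)
            gcongr
            · exact ih (M + 1)
            · exact hM.trans (by gcongr)
        _ = _ := by rw [Nat.factorial_succ]; push_cast; ring

/-! ### Forward differences -/

section ForwardDifference

variable {M G : Type*} [AddCommMonoid M] [AddCommGroup G]

theorem fwdDiff_iter_succ_apply (f : M → G) (h : M) (k : ℕ) (z : M) :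
    (fwdDiff h)^[k + 1] f z = (fwdDiff h)^[k] f (z + h) - (fwdDiff h)^[k] f z := by
  rw [Function.iterate_succ_apply', fwdDiff]

theorem hasSum_fwdDiff_iter [TopologicalSpace G] [IsTopologicalAddGroup G] {ι : Type*}
    {f : ι → M → G} {F : M → G} (hF : ∀ z, HasSum (fun i => f i z) (F z)) (h : M) (k : ℕ) (z : M) :
    HasSum (fun i => (fwdDiff h)^[k] (f i) z) ((fwdDiff h)^[k] F z) := by
  induction k generalizing z with
  | zero => exact hF z
  | succ k ih =>
    simp only [fwdDiff_iter_succ_apply]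
    exact (ih (z + h)).sub (ih z)

section Integral

variable {S : Type*} [MeasurableSpace S] {μ : MeasureTheory.Measure S} {E : Type*}
  [NormedAddCommGroup E] {f : S → M → E}

theorem integrable_fwdDiff_iter (hf : ∀ z, MeasureTheory.Integrable (fun s => f s z) μ)
    (h : M) (k : ℕ) (z : M) : MeasureTheory.Integrable (fun s => (fwdDiff h)^[k] (f s) z) μ := by
  induction k generalizing z with
  | zero => exact hf z
  | succ k ih =>
    simp only [fwdDiff_iter_succ_apply]
    exact (ih (z + h)).sub (ih z)

theorem fwdDiff_iter_integral [NormedSpace ℝ E]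
    (hf : ∀ z, MeasureTheory.Integrable (fun s => f s z) μ) (h : M) (k : ℕ) (z : M) :
    (fwdDiff h)^[k] (fun z => ∫ s, f s z ∂μ) z = ∫ s, (fwdDiff h)^[k] (f s) z ∂μ := by
  induction k generalizing z with
  | zero => rfl
  | succ k ih =>
    simp only [fwdDiff_iter_succ_apply, ih]
    exact (MeasureTheory.integral_sub (integrable_fwdDiff_iter hf h k (z + h))
      (integrable_fwdDiff_iter hf h k z)).symm

end Integral

theorem fwdDiff_iter_of_fwdDiff_eq_mul {R : Type*} [Ring R] {f : M → R} {h : M} {r : R}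
    (hf : ∀ z, fwdDiff h f z = r * f z) (k : ℕ) (z : M) : (fwdDiff h)^[k] f z = r ^ k * f z := by
  induction k generalizing z with
  | zero => simp
  | succ k ih =>
    rw [fwdDiff_iter_succ_apply, ih, ih, ← mul_sub, pow_succ, mul_assoc, ← hf, fwdDiff]

theorem fwdDiff_iter_succ_self_mul_comp_add_one {R : Type*} [CommRing R] (f : R → R) (k : ℕ)
    (z : R) : (fwdDiff 1)^[k + 1] (fun z => z * f (z + 1)) z
      = (z + k + 1) * (fwdDiff 1)^[k + 1] f (z + 1) + (k + 1) * (fwdDiff 1)^[k] f (z + 1) := by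
  induction k generalizing z with
  | zero =>
    simp only [Function.iterate_succ_apply, Function.iterate_zero, id_eq, fwdDiff, Nat.cast_zero]
    ring
  | succ k ih =>
    rw [fwdDiff_iter_succ_apply, ih, ih]
    push_cast
    linear_combination -(k + 1 : R) * fwdDiff_iter_succ_apply f 1 k (z + 1)
      - (z + k + 2) * fwdDiff_iter_succ_apply f 1 (k + 1) (z + 1)

end ForwardDifference

theorem fwdDiff_iter_poch (a : ℂ) (k M : ℕ) :
    (fwdDiff 1)^[k] (fun z => poch z M) a = M.descFactorial k * poch (a + k) (M - k) := by
  induction k generalizing a M with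
  | zero => simp
  | succ k ih =>
    rw [Function.iterate_succ_apply]
    rcases M with _ | M
    · simp only [poch_zero, fwdDiff_const, Nat.zero_descFactorial_succ, Nat.cast_zero, zero_mul]
      exact congrFun (Function.iterate_fixed (fwdDiff_const 1 (0 : ℂ)) k) a
    · have hstep : fwdDiff 1 (fun z => poch z (M + 1))
          = ((M : ℂ) + 1) • fun z => poch (z + 1) M := by
        ext z
        simp only [fwdDiff, Pi.smul_apply, smul_eq_mul]
        rw [poch_succ, poch_succ']
        ring
      rw [hstep, fwdDiff_iter_const_smul, Pi.smul_apply, smul_eq_mul,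
        fwdDiff_iter_comp_add 1 (fun z => poch z M), ih, Nat.succ_descFactorial_succ,
        Nat.succ_sub_succ]
      push_cast
      rw [add_assoc, add_comm (1 : ℂ)]
      ring

/-! ### Geometrically small differences and the backward Newton series -/

theorem multichoose_mul_le_one {z : ℝ} (h0 : 0 ≤ z) (h1 : z ≤ 1) (q j : ℕ) :
    q.multichoose j * (z ^ j * (1 - z) ^ q) ≤ 1 := by
  have hz : 0 ≤ 1 - z := sub_nonneg.mpr h1
  have hchoose : q.multichoose j ≤ (q + j).choose j := by
    rw [Nat.multichoose_eq]
    exact Nat.choose_mono j (Nat.sub_le _ _)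
  have hbinom : ∑ m ∈ range (q + j + 1), z ^ m * (1 - z) ^ (q + j - m) * (q + j).choose m = 1 := by
    rw [← add_pow, add_sub_cancel, one_pow]
  have hj : j ∈ range (q + j + 1) := mem_range.mpr (by omega)
  calc q.multichoose j * (z ^ j * (1 - z) ^ q)
      ≤ (q + j).choose j * (z ^ j * (1 - z) ^ q) := by gcongr
    _ = z ^ j * (1 - z) ^ (q + j - j) * (q + j).choose j := by
        rw [Nat.add_sub_cancel, mul_comm]
    _ ≤ 1 := hbinom ▸ single_le_sum
        (f := fun m => z ^ m * (1 - z) ^ (q + j - m) * ((q + j).choose m : ℝ))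
        (fun m _ => by positivity) hj

theorem multichoose_mul_pow_le {θ z : ℝ} (hθ : 0 ≤ θ) (h0 : 0 < z) (h1 : z < 1) (q j : ℕ) :
    q.multichoose j * θ ^ j ≤ (1 - z)⁻¹ ^ q * (θ / z) ^ j := by
  have hz : 0 < 1 - z := sub_pos.mpr h1
  calc q.multichoose j * θ ^ j
      = q.multichoose j * (z ^ j * (1 - z) ^ q) * ((1 - z)⁻¹ ^ q * (θ / z) ^ j) := by
        rw [div_pow, inv_pow]; field_simp
    _ ≤ 1 * ((1 - z)⁻¹ ^ q * (θ / z) ^ j) := by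
        gcongr; exact multichoose_mul_le_one h0.le h1.le q j
    _ = _ := one_mul _

theorem summable_multichoose_mul_pow {θ : ℝ} (hθ : 0 ≤ θ) (h1 : θ < 1) (q : ℕ) :
    Summable fun j : ℕ => q.multichoose j * θ ^ j := by
  obtain ⟨z, hz, hz1⟩ := exists_between h1
  have h0 : 0 < z := hθ.trans_lt hz
  exact ((summable_geometric_of_lt_one (by positivity) ((div_lt_one h0).mpr hz)).mul_left
    ((1 - z)⁻¹ ^ q)).of_nonneg_of_le (fun j => by positivity)
      fun j => multichoose_mul_pow_le hθ h0 hz1 q j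

theorem hasSum_sum_fiberwise {α β γ : Type*} [AddCommMonoid α] [TopologicalSpace α]
    [ContinuousAdd α] [RegularSpace α] {f : β → α} {a : α} (hf : HasSum f a) {g : β → γ}
    {s : γ → Finset β} (hs : ∀ b c, b ∈ s c ↔ g b = c) : HasSum (fun c => ∑ b ∈ s c, f b) a :=
  ((Equiv.sigmaFiberEquiv g).hasSum_iff.mpr hf).sigma fun c =>
    (Equiv.subtypeEquivRight fun b => hs b c).hasSum_iff.mp ((s c).hasSum f)

theorem sum_antidiagonal_multichoose (q s : ℕ) :
    ∑ ij ∈ antidiagonal s, q.multichoose ij.1 = (q + 1).multichoose s := by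
  rw [Nat.sum_antidiagonal_eq_sum_range_succ fun i _ => q.multichoose i]
  induction s with
  | zero => simp
  | succ s ih => rw [sum_range_succ, ih, Nat.multichoose_succ_succ, add_comm]

section GeometricDifferences

variable {𝕜 : Type*} [NormedField 𝕜]

/-- `f` has geometrically small differences if at every point `a` the iterated forward differences
`Δᵏ f (a)` with step `1` are `O(θᵏ)` for some `θ < 1`. This makes the Newton series of `f (a - q)`
in the differences of `f` at `a` converge for every `q ∈ ℕ`. -/
def HasGeometricDifferences (f : 𝕜 → 𝕜) : Prop :=
  ∀ a, ∃ θ ∈ Set.Ioo (0 : ℝ) 1, (fun k => (fwdDiff 1)^[k] f a) =O[atTop] fun k => θ ^ k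

theorem isBigO_pow_of_le {θ τ : ℝ} (hθ : 0 ≤ θ) (h : θ ≤ τ) :
    (fun k : ℕ => θ ^ k) =O[atTop] fun k => τ ^ k :=
  isBigO_of_le _ fun k => by
    rw [Real.norm_of_nonneg (pow_nonneg hθ k), Real.norm_of_nonneg (pow_nonneg (hθ.trans h) k)]
    exact pow_le_pow_left₀ hθ h k

theorem isBigO_natCast_mul_of_isBigO_pow {u : ℕ → 𝕜} {θ τ : ℝ} (hθ : 0 ≤ θ) (h : θ < τ)
    (hu : u =O[atTop] fun k => θ ^ k) :
    (fun k : ℕ => (k : 𝕜) * u k) =O[atTop] fun k => τ ^ k := by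
  have hcast : (fun k : ℕ => (k : 𝕜)) =O[atTop] fun k => (k : ℝ) := isBigO_of_le _ fun k => by
    simpa using Nat.norm_cast_le (α := 𝕜) k
  have hlittle := isLittleO_pow_const_mul_const_pow_const_pow_of_norm_lt 1
    (by rwa [Real.norm_of_nonneg hθ] : ‖θ‖ < τ)
  simp only [pow_one] at hlittle
  exact (hcast.mul hu).trans hlittle.isBigO

namespace HasGeometricDifferences

variable {f g : 𝕜 → 𝕜}

theorem add (hf : HasGeometricDifferences f) (hg : HasGeometricDifferences g) :
    HasGeometricDifferences (f + g) := fun a => by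
  obtain ⟨θ, hθ, hfθ⟩ := hf a
  obtain ⟨τ, hτ, hgτ⟩ := hg a
  refine ⟨max θ τ, ⟨lt_max_of_lt_left hθ.1, max_lt hθ.2 hτ.2⟩, ?_⟩
  simp only [fwdDiff_iter_add, Pi.add_apply]
  exact (hfθ.trans (isBigO_pow_of_le hθ.1.le (le_max_left _ _))).add
    (hgτ.trans (isBigO_pow_of_le hτ.1.le (le_max_right _ _)))

theorem const_smul (r : 𝕜) (hf : HasGeometricDifferences f) : HasGeometricDifferences (r • f) :=
  fun a => by
  obtain ⟨θ, hθ, hfθ⟩ := hf a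
  refine ⟨θ, hθ, ?_⟩
  simp only [fwdDiff_iter_const_smul, Pi.smul_apply, smul_eq_mul]
  exact hfθ.const_mul_left r

theorem self_mul_comp_add_one (hf : HasGeometricDifferences f) :
    HasGeometricDifferences fun z => z * f (z + 1) := fun a => by
  obtain ⟨θ, ⟨hθ, hθ1⟩, hfθ⟩ := hf (a + 1)
  obtain ⟨τ, hθτ, hτ1⟩ := exists_between hθ1
  have hτ : 0 < τ := hθ.trans hθτ
  have hfτ := hfθ.trans (isBigO_pow_of_le hθ.le hθτ.le)
  have hmul := isBigO_natCast_mul_of_isBigO_pow hθ.le hθτ hfθ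
  have hshift : (fun k : ℕ => τ ^ k) =O[atTop] fun k => τ ^ (k + 1) := by
    simp only [pow_succ']
    exact (isBigO_refl _ _).const_mul_right hτ.ne'
  refine ⟨τ, ⟨hτ, hτ1⟩, ?_⟩
  have hsucc : ∀ {u : ℕ → 𝕜}, (u =O[atTop] fun k => τ ^ k) →
      (fun k => u (k + 1)) =O[atTop] fun k => τ ^ (k + 1) := fun hu =>
    hu.comp_tendsto (tendsto_add_atTop_nat 1)
  rw [← map_add_atTop_eq_nat 1, isBigO_map]
  refine (((hsucc hfτ).const_mul_left a).add
    ((hsucc hmul).add ((hmul.add hfτ).trans hshift))).congr_left fun k => ?_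
  rw [Function.comp_apply, fwdDiff_iter_succ_self_mul_comp_add_one]
  push_cast
  ring

theorem exists_norm_le (hf : HasGeometricDifferences f) (a : 𝕜) :
    ∃ C θ : ℝ, 0 ≤ C ∧ 0 < θ ∧ θ < 1 ∧ ∀ k, ‖(fwdDiff 1)^[k] f a‖ ≤ C * θ ^ k := by
  obtain ⟨θ, ⟨hθ, hθ1⟩, hfθ⟩ := hf a
  obtain ⟨C, hC, hbound⟩ := bound_of_isBigO_nat_atTop hfθ
  refine ⟨C, θ, hC.le, hθ, hθ1, fun k => (hbound (pow_pos hθ k).ne').trans_eq ?_⟩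
  rw [Real.norm_of_nonneg (pow_nonneg hθ.le k)]

theorem fwdDiff_iter (hf : HasGeometricDifferences f) (i : ℕ) :
    HasGeometricDifferences ((fwdDiff 1)^[i] f) := fun a => by
  obtain ⟨θ, ⟨hθ, hθ1⟩, hfθ⟩ := hf a
  refine ⟨θ, ⟨hθ, hθ1⟩, ?_⟩
  simp only [← Function.iterate_add_apply]
  refine (hfθ.comp_tendsto (tendsto_add_atTop_nat i)).trans (isBigO_of_le _ fun k => ?_)
  rw [Function.comp_apply, Real.norm_of_nonneg (by positivity), Real.norm_of_nonneg (by positivity)]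
  exact pow_le_pow_of_le_one hθ.le hθ1.le (Nat.le_add_right k i)

theorem hasSum_sub_one [CompleteSpace 𝕜] (hf : HasGeometricDifferences f) (a : 𝕜) :
    HasSum (fun j => (-1) ^ j * (fwdDiff 1)^[j] f a) (f (a - 1)) := by
  have htelescope : ∀ j, (-1) ^ j * (fwdDiff 1)^[j] f a
      = (-1) ^ j * (fwdDiff 1)^[j] f (a - 1) - (-1) ^ (j + 1) * (fwdDiff 1)^[j + 1] f (a - 1) :=
    fun j => by rw [fwdDiff_iter_succ_apply, sub_add_cancel]; ring
  have hbounded : ∀ z, ∃ C θ : ℝ, 0 < θ ∧ θ < 1 ∧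
      ∀ j, ‖(-1) ^ j * (fwdDiff 1)^[j] f z‖ ≤ C * θ ^ j := fun z => by
    obtain ⟨C, θ, -, h⟩ := hf.exists_norm_le z
    simpa using ⟨C, θ, h⟩
  obtain ⟨C, θ, hθ, hθ1, hC⟩ := hbounded a
  have hsumm : Summable fun j => (-1) ^ j * (fwdDiff 1)^[j] f a :=
    .of_norm_bounded ((summable_geometric_of_lt_one hθ.le hθ1).mul_left C) hC
  have hlim : Tendsto (fun j => (-1) ^ j * (fwdDiff 1)^[j] f (a - 1)) atTop (𝓝 0) := by
    obtain ⟨C, θ, hθ, hθ1, hC⟩ := hbounded (a - 1)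
    refine squeeze_zero_norm hC ?_
    simpa using (tendsto_pow_atTop_nhds_zero_of_lt_one hθ.le hθ1).const_mul C
  refine (hsumm.hasSum_iff_tendsto_nat).mpr ?_
  simp only [htelescope, sum_range_sub']
  simpa using hlim.const_sub (f (a - 1))

theorem summable_multichoose_mul_fwdDiff_iter_add [CompleteSpace 𝕜] (hf : HasGeometricDifferences f)
    (a : 𝕜) (q : ℕ) :
    Summable fun ij : ℕ × ℕ =>
      (-1) ^ (ij.1 + ij.2) * q.multichoose ij.1 * (fwdDiff 1)^[ij.1 + ij.2] f a := by
  obtain ⟨C, θ, -, hθ, hθ1, hbound⟩ := hf.exists_norm_le a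
  refine .of_norm_bounded (((summable_multichoose_mul_pow hθ.le hθ1 q).mul_of_nonneg
    (summable_geometric_of_lt_one hθ.le hθ1) (fun i => by positivity)
      fun l => by positivity).mul_left C) fun ⟨i, l⟩ => ?_
  rw [norm_mul, norm_mul, norm_pow, norm_neg, norm_one, one_pow, one_mul]
  calc ‖(q.multichoose i : 𝕜)‖ * ‖(fwdDiff 1)^[i + l] f a‖
      ≤ q.multichoose i * (C * θ ^ (i + l)) := by
        gcongr
        · simpa using Nat.norm_cast_le (α := 𝕜) (q.multichoose i)
        · exact hbound _
    _ = C * (q.multichoose i * θ ^ i * θ ^ l) := by ring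

theorem hasSum_sub_natCast [CompleteSpace 𝕜] (hf : HasGeometricDifferences f) (a : 𝕜) (q : ℕ) :
    HasSum (fun j => (-1) ^ j * q.multichoose j * (fwdDiff 1)^[j] f a) (f (a - q)) := by
  induction q generalizing f a with
  | zero =>
    have hvanish : ∀ j ≠ 0, (-1) ^ j * (Nat.multichoose 0 j : 𝕜) * (fwdDiff 1)^[j] f a = 0 := by
      rintro (_ | j) hj
      · exact absurd rfl hj
      · simp
    simpa using hasSum_single 0 hvanish
  | succ q ih =>
    set F : ℕ × ℕ → 𝕜 := fun ij =>
      (-1) ^ (ij.1 + ij.2) * q.multichoose ij.1 * (fwdDiff 1)^[ij.1 + ij.2] f a with hF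
    have hsumm : Summable F := hf.summable_multichoose_mul_fwdDiff_iter_add a q
    have hrow : ∀ i, HasSum (fun l => F (i, l))
        ((-1) ^ i * q.multichoose i * (fwdDiff 1)^[i] f (a - 1)) := fun i => by
      have hterm : ∀ l, F (i, l) = (-1) ^ i * q.multichoose i *
          ((-1) ^ l * (fwdDiff 1)^[l] ((fwdDiff 1)^[i] f) a) := fun l => by
        rw [← Function.iterate_add_apply, add_comm l i, hF]
        ring
      simpa only [hterm] using ((hf.fwdDiff_iter i).hasSum_sub_one a).mul_left _
    have hdiag : ∀ s, ∑ ij ∈ antidiagonal s, F ij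
        = (-1) ^ s * (q + 1).multichoose s * (fwdDiff 1)^[s] f a := fun s => by
      rw [← sum_antidiagonal_multichoose, Nat.cast_sum, mul_sum, sum_mul]
      exact sum_congr rfl fun ij hij => by rw [hF, ← mem_antidiagonal.mp hij]
    have hvalue : ∑' ij, F ij = f (a - (q + 1 : ℕ)) := by
      rw [Nat.cast_succ, add_comm, ← sub_sub]
      exact (hsumm.hasSum.prod_fiberwise hrow).unique (ih hf (a - 1))
    simpa only [hdiag, hvalue] using
      hasSum_sum_fiberwise hsumm.hasSum (g := fun ij => ij.1 + ij.2) fun _ _ => mem_antidiagonal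

end HasGeometricDifferences

end GeometricDifferences

/-! ### Multinomial sums -/

section Multinomial

variable {ι : Type*} [Fintype ι]

theorem sum_piAntidiag_factorial_mul_prod [DecidableEq ι] {K : Type*} [Field K] [CharZero K]
    (r : ι → K) (M : ℕ) :
    ∑ m ∈ piAntidiag univ M, (M.factorial : K) * ∏ i, (r i ^ m i / (m i).factorial)
      = (∑ i, r i) ^ M := by
  rw [sum_pow_eq_sum_piAntidiag]
  refine sum_congr rfl fun m hm => ?_
  have hspec : (∏ i, ((m i).factorial : K)) * Nat.multinomial univ m = M.factorial := by
    rw [← (mem_piAntidiag.mp hm).1]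
    exact_mod_cast Nat.multinomial_spec univ m
  have hne : (∏ i, ((m i).factorial : K)) ≠ 0 :=
    prod_ne_zero_iff.mpr fun i _ => Nat.cast_ne_zero.mpr (m i).factorial_ne_zero
  rw [prod_div_distrib, ← hspec]
  field_simp

theorem sum_piAntidiag_mul_factorial_mul_prod [DecidableEq ι] {K : Type*} [Field K] [CharZero K]
    (w : ℕ → K) (r : ι → K) (M : ℕ) :
    ∑ m ∈ piAntidiag univ M, w (∑ i, m i) *
        ((∑ i, m i).factorial * ∏ i, (r i ^ m i / (m i).factorial)) = w M * (∑ i, r i) ^ M := by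
  rw [← sum_piAntidiag_factorial_mul_prod, mul_sum]
  exact sum_congr rfl fun m hm => by rw [(mem_piAntidiag.mp hm).1]

theorem summable_of_summable_sum_piAntidiag [DecidableEq ι] {f : (ι → ℕ) → ℝ}
    (hf : ∀ m, 0 ≤ f m) (h : Summable fun M : ℕ => ∑ m ∈ piAntidiag univ M, f m) : Summable f := by
  refine summable_of_sum_le (c := ∑' M : ℕ, ∑ m ∈ piAntidiag univ M, f m) hf fun s => ?_
  let degree : (ι → ℕ) → ℕ := fun m => ∑ i, m i
  calc ∑ m ∈ s, f m = ∑ M ∈ s.image degree, ∑ m ∈ s with degree m = M, f m :=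
        (sum_fiberwise_of_maps_to (fun m hm => mem_image_of_mem degree hm) f).symm
    _ ≤ ∑ M ∈ s.image degree, ∑ m ∈ piAntidiag univ M, f m :=
        sum_le_sum fun M _ => sum_le_sum_of_subset_of_nonneg
          (fun m hm => by simpa using (mem_filter.mp hm).2) fun m _ _ => hf m
    _ ≤ _ := h.sum_le_tsum _ fun M _ => sum_nonneg fun m _ => hf m

theorem summable_mul_factorial_mul_prod {w : ℕ → ℝ} (hw : ∀ M, 0 ≤ w M) {r : ι → ℝ}
    (hr : ∀ i, 0 ≤ r i) (h : Summable fun M => w M * (∑ i, r i) ^ M) :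
    Summable fun m : ι → ℕ =>
      w (∑ i, m i) * ((∑ i, m i).factorial * ∏ i, (r i ^ m i / (m i).factorial)) := by
  classical
  refine summable_of_summable_sum_piAntidiag (fun m => mul_nonneg (hw _) (mul_nonneg (by positivity)
    (prod_nonneg fun i _ => div_nonneg (pow_nonneg (hr i) _) (by positivity)))) ?_
  simpa only [sum_piAntidiag_mul_factorial_mul_prod] using h

theorem summable_norm_mul_factorial_mul_prod {𝕜 : Type*} [RCLike 𝕜] {w : ℕ → 𝕜} {r : ι → 𝕜}
    (h : Summable fun M => ‖w M‖ * (∑ i, ‖r i‖) ^ M) :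
    Summable fun m : ι → ℕ =>
      ‖w (∑ i, m i) * ((∑ i, m i).factorial * ∏ i, (r i ^ m i / (m i).factorial))‖ := by
  simpa only [norm_mul, norm_prod, norm_div, norm_pow, RCLike.norm_natCast] using
    summable_mul_factorial_mul_prod (fun M => norm_nonneg (w M)) (fun i => norm_nonneg (r i)) h

theorem hasSum_mul_factorial_mul_prod {𝕜 : Type*} [RCLike 𝕜] {w : ℕ → 𝕜} {r : ι → 𝕜} {a : 𝕜}
    (h : Summable fun M => ‖w M‖ * (∑ i, ‖r i‖) ^ M)
    (ha : HasSum (fun M => w M * (∑ i, r i) ^ M) a) :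
    HasSum (fun m : ι → ℕ =>
      w (∑ i, m i) * ((∑ i, m i).factorial * ∏ i, (r i ^ m i / (m i).factorial))) a := by
  classical
  have hsum := (summable_norm_mul_factorial_mul_prod h).of_norm.hasSum
  have hfiber := hasSum_sum_fiberwise hsum (g := fun m => ∑ i, m i)
    (s := fun M => piAntidiag univ M) fun m M => by simp
  simp only [sum_piAntidiag_mul_factorial_mul_prod] at hfiber
  rwa [hfiber.unique ha] at hsum

end Multinomial

/-! ### Absolute convergence of the hypergeometric series -/

theorem exists_one_lt_mul_lt {σ : ℝ} (h0 : 0 ≤ σ) (h1 : σ < 1) :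
    ∃ η : ℝ, 1 < η ∧ η * (η * σ) < 1 := by
  refine ⟨2 / (1 + σ), ?_, ?_⟩
  · rw [lt_div_iff₀ (by linarith)]
    linarith
  · rw [show 2 / (1 + σ) * (2 / (1 + σ) * σ) = 4 * σ / (1 + σ) ^ 2 by field_simp; ring,
      div_lt_one (by positivity)]
    nlinarith [sq_pos_of_pos (sub_pos.mpr h1)]

/-- The general term `(b)_m x^m / ((c)_m m!)` of Kummer's series `₁F₁(b; c; x)`. The general term of
`F_A(a, b; c; x)` is `(a)_{|m|}` times a product of such terms. -/
noncomputable def kummerTerm (b c x : ℂ) (m : ℕ) : ℂ := poch b m / (poch c m * m.factorial) * x ^ m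

theorem lauricellaATerm_eq {n : ℕ} (a : ℂ) (b c x : Fin n → ℂ) (m : Fin n → ℕ) :
    lauricellaATerm a b c x m = poch a (∑ i, m i) * ∏ i, kummerTerm (b i) (c i) (x i) (m i) := rfl

section Kummer

variable {ι : Type*} [Fintype ι] (b : ι → ℂ) {c : ι → ℂ} (hc : ∀ i, ∀ m : ℕ, c i ≠ -m)

include hc

theorem exists_norm_prod_kummerTerm_le (x : ι → ℂ) {η : ℝ} (hη : 1 < η) :
    ∃ C, 0 ≤ C ∧ ∀ m : ι → ℕ, ‖∏ i, kummerTerm (b i) (c i) (x i) (m i)‖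
      ≤ C * ∏ i, ((η * ‖x i‖) ^ m i / (m i).factorial) := by
  choose C hC h using fun i => exists_norm_poch_div_poch_le (b i) (hc i) hη
  refine ⟨∏ i, C i, prod_nonneg fun i _ => hC i, fun m => ?_⟩
  rw [norm_prod, ← prod_mul_distrib]
  refine prod_le_prod (fun i _ => norm_nonneg _) fun i _ => ?_
  rw [kummerTerm, ← div_div, norm_mul, norm_div, norm_pow, Complex.norm_natCast, mul_pow]
  calc ‖poch (b i) (m i) / poch (c i) (m i)‖ / (m i).factorial * ‖x i‖ ^ m i
      ≤ C i * η ^ m i / (m i).factorial * ‖x i‖ ^ m i := by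
        gcongr
        exact h i (m i)
    _ = _ := by ring

theorem exists_summable_factorial_mul_kummerTerm {x : ι → ℂ} (hx : ∑ i, ‖x i‖ < 1) :
    ∃ η : ℝ, 1 < η ∧ Summable fun m : ι → ℕ =>
      η ^ (∑ i, m i) * (∑ i, m i).factorial * ‖∏ i, kummerTerm (b i) (c i) (x i) (m i)‖ := by
  classical
  have hx0 : 0 ≤ ∑ i, ‖x i‖ := sum_nonneg fun i _ => norm_nonneg (x i)
  obtain ⟨η, hη, hη2⟩ := exists_one_lt_mul_lt hx0 hx
  obtain ⟨C, hC, hbound⟩ := exists_norm_prod_kummerTerm_le b hc x hη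
  have hgeom : Summable fun M : ℕ => C * η ^ M * (∑ i, η * ‖x i‖) ^ M := by
    simp_rw [← mul_sum, mul_assoc C, ← mul_pow]
    exact (summable_geometric_of_lt_one (by positivity) hη2).mul_left _
  refine ⟨η, hη, (summable_mul_factorial_mul_prod (fun M => by positivity)
    (fun i => by positivity) hgeom).of_nonneg_of_le (fun m => by positivity) fun m => ?_⟩
  calc η ^ (∑ i, m i) * (∑ i, m i).factorial * ‖∏ i, kummerTerm (b i) (c i) (x i) (m i)‖
      ≤ η ^ (∑ i, m i) * (∑ i, m i).factorial *
          (C * ∏ i, ((η * ‖x i‖) ^ m i / (m i).factorial)) := by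
        gcongr
        exact hbound m
    _ = _ := by ring

end Kummer

theorem summable_lauricellaATerm {n : ℕ} (a : ℂ) (b : Fin n → ℂ) {c : Fin n → ℂ}
    (hc : ∀ i, ∀ m : ℕ, c i ≠ -m) {x : Fin n → ℂ} (hx : ∑ i, ‖x i‖ < 1) :
    Summable (lauricellaATerm a b c x) := by
  obtain ⟨η, hη, hsum⟩ := exists_summable_factorial_mul_kummerTerm b hc hx
  obtain ⟨C, -, hbound⟩ := exists_norm_poch_le a hη
  refine .of_norm_bounded (hsum.mul_left C) fun m => ?_
  rw [lauricellaATerm_eq, norm_mul, ← mul_assoc, ← mul_assoc]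
  gcongr
  exact hbound _

theorem summable_pow_mul_zeroFTerm {p : ℕ} {d : ℂ} (hd : ∀ m : ℕ, d ≠ -m) (y : Fin p → ℂ)
    {Z : ℝ} (hZ : 0 ≤ Z) : Summable fun q : Fin p → ℕ => Z ^ (∑ j, q j) * ‖zeroFTerm d y q‖ := by
  obtain ⟨C, hC, hbound⟩ := exists_norm_inv_poch_le hd one_lt_two
  have hy : 0 ≤ ∑ j, ‖y j‖ := sum_nonneg fun j _ => norm_nonneg _
  have hexp : Summable fun Q : ℕ =>
      C * (2 * Z) ^ Q / Q.factorial / Q.factorial * (∑ j, ‖y j‖) ^ Q := by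
    refine ((Real.summable_pow_div_factorial (2 * Z * ∑ j, ‖y j‖)).mul_left C).of_nonneg_of_le
      (fun Q => by positivity) fun Q => ?_
    calc C * (2 * Z) ^ Q / Q.factorial / Q.factorial * (∑ j, ‖y j‖) ^ Q
        ≤ C * (2 * Z) ^ Q / Q.factorial * (∑ j, ‖y j‖) ^ Q := by
          gcongr
          exact div_le_self (by positivity) (Nat.one_le_cast.mpr Q.factorial_pos)
      _ = C * ((2 * Z * ∑ j, ‖y j‖) ^ Q / Q.factorial) := by
          rw [mul_pow (2 * Z)]
          ring
  refine (summable_mul_factorial_mul_prod (fun Q => by positivity) (fun j => norm_nonneg _)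
    hexp).of_nonneg_of_le (fun q => by positivity) fun q => ?_
  rw [zeroFTerm, norm_mul, norm_prod]
  simp only [norm_div, norm_pow, Complex.norm_natCast]
  calc Z ^ (∑ j, q j) * (‖(poch d (∑ j, q j))⁻¹‖ * ∏ j, (‖y j‖ ^ q j / ((q j).factorial : ℝ)))
      ≤ Z ^ (∑ j, q j) * ((C * 2 ^ (∑ j, q j) / (∑ j, q j).factorial)
          * ∏ j, (‖y j‖ ^ q j / ((q j).factorial : ℝ))) := by
        gcongr
        exact hbound _
    _ = _ := by
        rw [mul_pow]
        field_simp

theorem summable_zeroFTerm {p : ℕ} {d : ℂ} (hd : ∀ m : ℕ, d ≠ -m) (y : Fin p → ℂ) :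
    Summable (zeroFTerm d y) := by
  refine .of_norm ?_
  simpa only [one_pow, one_mul] using summable_pow_mul_zeroFTerm hd y zero_le_one

theorem summable_multichoose_mul_zeroFTerm {p : ℕ} {d : ℂ} (hd : ∀ m : ℕ, d ≠ -m) (y : Fin p → ℂ)
    (k : ℕ) : Summable fun q : Fin p → ℕ => ((∑ j, q j).multichoose k : ℂ) * zeroFTerm d y q := by
  refine .of_norm_bounded ((summable_pow_mul_zeroFTerm hd y zero_le_two).mul_left (2 ^ k))
    fun q => ?_
  have hchoose : ((∑ j, q j).multichoose k : ℝ) ≤ 2 ^ (∑ j, q j) * 2 ^ k := by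
    have := multichoose_mul_pow_le zero_le_one (z := 1 / 2) (by norm_num) (by norm_num)
      (∑ j, q j) k
    norm_num only [one_pow, mul_one] at this
    exact this
  rw [norm_mul, Complex.norm_natCast, ← mul_assoc, mul_comm (2 ^ k)]
  gcongr

theorem confluentHATerm_eq {n p : ℕ} {a : ℂ} (ha : ∀ m : ℕ, a ≠ m + 1) (b c x : Fin n → ℂ)
    (y : Fin p → ℂ) (m : Fin n → ℕ) (q : Fin p → ℕ) :
    confluentHATerm a b c x y (m, q)
      = lauricellaATerm (a - (∑ j, q j : ℕ)) b c x m * zeroFTerm (1 - a) (-y) q := by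
  have hpoch := pochZ_sub ha (∑ i, m i) (∑ j, q j)
  have hsign : ∏ j, ((-y) j ^ q j / ((q j).factorial : ℂ))
      = ((-1) ^ (∑ j, q j))⁻¹ * ∏ j, (y j ^ q j / ((q j).factorial : ℂ)) := by
    rw [← inv_pow, inv_neg_one, ← prod_pow_eq_pow_sum, ← prod_mul_distrib]
    exact prod_congr rfl fun j _ => by rw [Pi.neg_apply, neg_pow, mul_div_assoc]
  rw [poch_sub_natCast a (∑ j, q j)] at hpoch
  push_cast at hpoch
  rw [confluentHATerm, lauricellaATerm, zeroFTerm, hsign, hpoch]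
  push_cast
  ring

theorem summable_confluentHATerm {n p : ℕ} {a : ℂ} (ha : ∀ m : ℕ, a ≠ m + 1) (b : Fin n → ℂ)
    {c x : Fin n → ℂ} (hc : ∀ i, ∀ m : ℕ, c i ≠ -m) (hx : ∑ i, ‖x i‖ < 1) (y : Fin p → ℂ) :
    Summable (confluentHATerm a b c x y) := by
  obtain ⟨η, hη, hsum⟩ := exists_summable_factorial_mul_kummerTerm b hc hx
  obtain ⟨C, hC, hbound⟩ := exists_norm_poch_sub_natCast_le a hη
  refine .of_norm_bounded (hsum.mul_of_nonneg ((summable_pow_mul_zeroFTerm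
    (one_sub_ne_neg_natCast ha) (-y) zero_le_two).mul_left C) (fun m => by positivity)
      fun q => by positivity) ?_
  rintro ⟨m, q⟩
  rw [confluentHATerm_eq ha, lauricellaATerm_eq, norm_mul, norm_mul]
  calc _ ≤ C * 2 ^ (∑ j, q j) * η ^ (∑ i, m i) * (∑ i, m i).factorial
        * ‖∏ i, kummerTerm (b i) (c i) (x i) (m i)‖ * ‖zeroFTerm (1 - a) (-y) q‖ := by
        gcongr
        exact hbound _ _
    _ = _ := by ring

/-! ### Contiguous relations for `F_A` -/

theorem kummerTerm_zero (b c x : ℂ) : kummerTerm b c x 0 = 1 := by simp [kummerTerm, poch_zero]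

theorem kummerTerm_succ_eq_sub {c : ℂ} (hc : ∀ m : ℕ, c ≠ -m) (b x : ℂ) (m : ℕ) :
    kummerTerm b c x (m + 1)
      = kummerTerm (b + 1) c x (m + 1) + -(x / c) * kummerTerm (b + 1) (c + 1) x m := by
  have hc0 : c ≠ 0 := by simpa using hc 0
  have hc1 : poch (c + 1) m ≠ 0 := poch_ne_zero (by simpa using add_natCast_ne_neg_natCast hc 1) m
  simp only [kummerTerm]
  rw [poch_succ' b, poch_succ (b + 1), poch_succ' c, Nat.factorial_succ]
  push_cast
  field_simp
  ring

theorem kummerTerm_succ_eq_add {c : ℂ} (hc : ∀ m : ℕ, c ≠ -m) (b x : ℂ) (m : ℕ) :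
    kummerTerm b c x (m + 1) = kummerTerm b (c + 1) x (m + 1)
      + b * x / (c * (c + 1)) * kummerTerm (b + 1) (c + 2) x m := by
  have hc0 : c ≠ 0 := by simpa using hc 0
  have hc1 : c + 1 ≠ 0 := by simpa using add_natCast_ne_neg_natCast hc 1 0
  have hcm : c + 1 + m ≠ 0 := fun h => hc (m + 1) (by push_cast; linear_combination h)
  have hc2 : poch (c + 2) m ≠ 0 := poch_ne_zero (by simpa using add_natCast_ne_neg_natCast hc 2) m
  have hsucc : poch (c + 1) (m + 1) = (c + 1) * poch (c + 2) m := by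
    rw [poch_succ', show c + 1 + 1 = c + 2 by ring]
  have hpoch : poch c (m + 1) = c * (c + 1) * poch (c + 2) m / (c + 1 + m) := by
    rw [eq_div_iff hcm, mul_assoc c, ← hsucc, poch_succ', poch_succ, mul_assoc]
  simp only [kummerTerm]
  rw [poch_succ' b, hpoch, hsucc, Nat.factorial_succ]
  push_cast
  field_simp
  ring

theorem hasSum_of_hasSum_add_single {ι : Type*} [DecidableEq ι] {α : Type*} [AddCommMonoid α]
    [TopologicalSpace α] {f : (ι → ℕ) → α} {s : α} (i : ι)
    (h0 : ∀ m : ι → ℕ, m i = 0 → f m = 0)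
    (h : HasSum (fun m : ι → ℕ => f (m + Pi.single i 1)) s) : HasSum f s := by
  have hinj : Function.Injective fun m : ι → ℕ => m + Pi.single i 1 := add_left_injective _
  refine (hinj.hasSum_iff fun m hm => h0 m ?_).mp h
  by_contra hmi
  refine hm ⟨m - Pi.single i 1, funext fun j => ?_⟩
  rcases eq_or_ne j i with rfl | hj
  · simp only [Pi.add_apply, Pi.sub_apply, Pi.single_eq_same]
    omega
  · simp [hj]

theorem prod_kummerTerm_update {ι : Type*} [Fintype ι] [DecidableEq ι] (b c x : ι → ℂ) (i : ι)
    (β γ : ℂ) (m : ι → ℕ) :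
    ∏ j, kummerTerm (update b i β j) (update c i γ j) (x j) (m j)
      = kummerTerm β γ (x i) (m i) * ∏ j ∈ univ.erase i, kummerTerm (b j) (c j) (x j) (m j) := by
  rw [← mul_prod_erase univ _ (mem_univ i), Function.update_self, Function.update_self]
  congr 1
  exact prod_congr rfl fun j hj => by
    rw [Function.update_of_ne (ne_of_mem_erase hj), Function.update_of_ne (ne_of_mem_erase hj)]

theorem forall_update_ne_neg_natCast {ι : Type*} [DecidableEq ι] {c : ι → ℂ}
    (hc : ∀ j, ∀ m : ℕ, c j ≠ -m) {i : ι} {γ : ℂ} (hγ : ∀ m : ℕ, γ ≠ -m) (j : ι) (m : ℕ) :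
    update c i γ j ≠ -m := by
  rcases eq_or_ne j i with rfl | hj
  · simpa using hγ m
  · simpa [hj] using hc j m

/-- A three-term relation between Kummer terms in the `i`-th variable gives one between Lauricella
functions: the shift of `m_i` turns `(a)_{|m|}` into `a (a + 1)_{|m| - 1}`. -/
theorem lauricellaA_eq_add_of_kummerTerm_succ {n : ℕ} {b c x : Fin n → ℂ}
    (hc : ∀ j, ∀ m : ℕ, c j ≠ -m) (hx : ∑ j, ‖x j‖ < 1) {i : Fin n} {β β' γ γ' r : ℂ}
    (hγ : ∀ m : ℕ, γ ≠ -m) (hγ' : ∀ m : ℕ, γ' ≠ -m)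
    (h : ∀ m, kummerTerm (b i) (c i) (x i) (m + 1)
      = kummerTerm β γ (x i) (m + 1) + r * kummerTerm β' γ' (x i) m) (a : ℂ) :
    lauricellaA a b c x = lauricellaA a (update b i β) (update c i γ) x
      + r * (a * lauricellaA (a + 1) (update b i β') (update c i γ') x) := by
  have hsum₁ : HasSum _ (lauricellaA a (update b i β) (update c i γ) x) :=
    (summable_lauricellaATerm a _ (forall_update_ne_neg_natCast hc hγ) hx).hasSum
  have hsum₂ : HasSum _ (lauricellaA (a + 1) (update b i β') (update c i γ') x) :=
    (summable_lauricellaATerm (a + 1) _ (forall_update_ne_neg_natCast hc hγ') hx).hasSum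
  have hsplit : ∀ m : Fin n → ℕ, ∏ j, kummerTerm (b j) (c j) (x j) (m j)
      = kummerTerm (b i) (c i) (x i) (m i)
        * ∏ j ∈ univ.erase i, kummerTerm (b j) (c j) (x j) (m j) := fun m =>
    (mul_prod_erase univ _ (mem_univ i)).symm
  have hdiff : HasSum (fun m => lauricellaATerm a b c x m
      - lauricellaATerm a (update b i β) (update c i γ) x m)
      (r * (a * lauricellaA (a + 1) (update b i β') (update c i γ') x)) := by
    refine hasSum_of_hasSum_add_single i (fun m hm => ?_) (((hsum₂.mul_left a).mul_left r).congr_fun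
      fun m => ?_)
    · rw [lauricellaATerm_eq, lauricellaATerm_eq, hsplit, prod_kummerTerm_update, hm,
        kummerTerm_zero, kummerTerm_zero, sub_self]
    · have herase : ∏ j ∈ univ.erase i,
          kummerTerm (b j) (c j) (x j) ((m + Pi.single i 1 : Fin n → ℕ) j)
          = ∏ j ∈ univ.erase i, kummerTerm (b j) (c j) (x j) (m j) :=
        prod_congr rfl fun j hj => by simp [ne_of_mem_erase hj]
      have hdeg : ∑ j, (m + Pi.single i 1 : Fin n → ℕ) j = (∑ j, m j) + 1 := by
        simp [sum_add_distrib]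
      simp only [lauricellaATerm_eq]
      rw [hsplit, prod_kummerTerm_update, prod_kummerTerm_update, herase, hdeg, poch_succ',
        Pi.add_apply, Pi.single_eq_same, h]
      ring
  rw [← (hsum₁.add hdiff).tsum_eq, lauricellaA]
  exact tsum_congr fun m => (add_sub_cancel _ _).symm

theorem lauricellaA_eq_sub {n : ℕ} {b c x : Fin n → ℂ} (hc : ∀ j, ∀ m : ℕ, c j ≠ -m)
    (hx : ∑ j, ‖x j‖ < 1) (i : Fin n) (a : ℂ) :
    lauricellaA a b c x = lauricellaA a (update b i (b i + 1)) c x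
      + -(x i / c i) *
        (a * lauricellaA (a + 1) (update b i (b i + 1)) (update c i (c i + 1)) x) := by
  simpa only [Function.update_eq_self] using lauricellaA_eq_add_of_kummerTerm_succ hc hx (hc i)
    (by simpa using add_natCast_ne_neg_natCast (hc i) 1) (kummerTerm_succ_eq_sub (hc i) (b i) (x i))
    a

theorem lauricellaA_eq_add {n : ℕ} {b c x : Fin n → ℂ} (hc : ∀ j, ∀ m : ℕ, c j ≠ -m)
    (hx : ∑ j, ‖x j‖ < 1) (i : Fin n) (a : ℂ) :
    lauricellaA a b c x = lauricellaA a b (update c i (c i + 1)) x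
      + b i * x i / (c i * (c i + 1)) *
        (a * lauricellaA (a + 1) (update b i (b i + 1)) (update c i (c i + 2)) x) := by
  simpa only [Function.update_eq_self] using lauricellaA_eq_add_of_kummerTerm_succ hc hx
    (by simpa using add_natCast_ne_neg_natCast (hc i) 1)
    (by simpa using add_natCast_ne_neg_natCast (hc i) 2) (kummerTerm_succ_eq_add (hc i) (b i) (x i))
    a

/-! ### Reduction to parameters of positive real part -/

theorem ne_neg_natCast_of_re_pos {z : ℂ} (hz : 0 < z.re) (m : ℕ) : z ≠ -m := fun h => by
  rw [h, Complex.neg_re, Complex.natCast_re] at hz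
  exact hz.not_ge (neg_nonpos.mpr m.cast_nonneg)

theorem forall_of_re_pos_of_contiguous {P : ℂ → ℂ → Prop}
    (hbase : ∀ b c : ℂ, 0 < b.re → 0 < (c - b).re → P b c)
    (hb : ∀ b c : ℂ, (∀ m : ℕ, c ≠ -m) → P (b + 1) c → P (b + 1) (c + 1) → P b c)
    (hc : ∀ b c : ℂ, (∀ m : ℕ, c ≠ -m) → P b (c + 1) → P (b + 1) (c + 2) → P b c) (b c : ℂ)
    (hcm : ∀ m : ℕ, c ≠ -m) : P b c := by
  have lower_b : ∀ N : ℕ, ∀ b c : ℂ, -(N : ℝ) < b.re → N < (c - b).re → P b c := fun N => by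
    induction N with
    | zero => exact fun b c h₁ h₂ => hbase b c (by simpa using h₁) (by simpa using h₂)
    | succ N ih =>
      intro b c h₁ h₂
      push_cast at h₁ h₂
      rw [Complex.sub_re] at h₂
      refine hb b c (ne_neg_natCast_of_re_pos (by linarith)) (ih _ _ ?_ ?_) (ih _ _ ?_ ?_) <;>
        simp only [Complex.sub_re, Complex.add_re, Complex.one_re] <;> linarith
  obtain ⟨N, hN⟩ := exists_nat_gt (-b.re)
  have lower_c : ∀ J : ℕ, ∀ b c : ℂ, (∀ m : ℕ, c ≠ -m) → -(N : ℝ) < b.re →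
      (N : ℝ) - J < (c - b).re → P b c := fun J => by
    induction J with
    | zero => exact fun b c _ h₁ h₂ => lower_b N b c h₁ (by simpa using h₂)
    | succ J ih =>
      intro b c hcm h₁ h₂
      push_cast at h₂
      rw [Complex.sub_re] at h₂
      refine hc b c hcm
        (ih _ _ (by simpa using add_natCast_ne_neg_natCast hcm 1) h₁ ?_)
        (ih _ _ (by simpa using add_natCast_ne_neg_natCast hcm 2) ?_ ?_) <;>
        simp only [Complex.sub_re, Complex.add_re, Complex.one_re, Complex.re_ofNat] <;> linarith
  obtain ⟨J, hJ⟩ := exists_nat_gt ((N : ℝ) - (c - b).re)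
  exact lower_c J b c hcm (by linarith) (by linarith)

theorem forall_pi_of_re_pos_of_contiguous {ι : Type*} [Finite ι] [DecidableEq ι]
    {P : (ι → ℂ) → (ι → ℂ) → Prop}
    (hbase : ∀ b c : ι → ℂ, (∀ i, 0 < (b i).re ∧ 0 < (c i - b i).re) → P b c)
    (hb : ∀ (i) (b c : ι → ℂ), (∀ j, ∀ m : ℕ, c j ≠ -m) → P (update b i (b i + 1)) c →
      P (update b i (b i + 1)) (update c i (c i + 1)) → P b c)
    (hc : ∀ (i) (b c : ι → ℂ), (∀ j, ∀ m : ℕ, c j ≠ -m) → P b (update c i (c i + 1)) →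
      P (update b i (b i + 1)) (update c i (c i + 2)) → P b c) (b c : ι → ℂ)
    (hcm : ∀ j, ∀ m : ℕ, c j ≠ -m) : P b c := by
  cases nonempty_fintype ι
  suffices hfinset : ∀ s : Finset ι, ∀ b c : ι → ℂ, (∀ i, ∀ m : ℕ, c i ≠ -m) →
      (∀ i, i ∉ s → 0 < (b i).re ∧ 0 < (c i - b i).re) → P b c from
    hfinset univ b c hcm fun i hi => absurd (mem_univ i) hi
  intro s
  induction s using Finset.induction_on with
  | empty => exact fun b c _ h => hbase b c fun i => h i (notMem_empty i)
  | insert i s _ ih =>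
    intro b c hcm h
    suffices hi : ∀ β γ : ℂ, (∀ m : ℕ, γ ≠ -m) → P (update b i β) (update c i γ) by
      simpa using hi (b i) (c i) (hcm i)
    refine forall_of_re_pos_of_contiguous (fun β γ hβ hγ => ?_)
      (fun β γ hγ h₁ h₂ => hb i _ _ (forall_update_ne_neg_natCast hcm hγ) ?_ ?_)
      (fun β γ hγ h₁ h₂ => hc i _ _ (forall_update_ne_neg_natCast hcm hγ) ?_ ?_)
    · have hre : 0 < γ.re := by
        rw [Complex.sub_re] at hγ
        linarith
      refine ih _ _ (forall_update_ne_neg_natCast hcm (ne_neg_natCast_of_re_pos hre)) fun j hj => ?_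
      rcases eq_or_ne j i with rfl | hji
      · simpa only [Function.update_self] using ⟨hβ, hγ⟩
      · simpa only [Function.update_of_ne hji] using h j (by simp [hji, hj])
    all_goals simpa

/-! ### The Euler integral of `F_A` -/

theorem poch_div_factorial (a : ℂ) (j : ℕ) :
    poch a j / j.factorial = Ring.choose (a + j - 1) j := by
  have hpoch : (ascPochhammer ℂ j).eval a = poch a j := by
    induction j with
    | zero => simp [poch_zero]
    | succ j ih => rw [ascPochhammer_succ_eval, ih, poch_succ]
  rw [← Ring.multichoose_eq, div_eq_iff (Nat.cast_ne_zero.mpr j.factorial_ne_zero), ← hpoch,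
    ← Polynomial.ascPochhammer_smeval_eq_eval, ← Ring.factorial_nsmul_multichoose_eq_ascPochhammer,
    nsmul_eq_mul, mul_comm]

theorem hasSum_one_sub_cpow_neg (a : ℂ) {X : ℂ} (hX : ‖X‖ < 1) :
    HasSum (fun j : ℕ => poch a j / j.factorial * X ^ j) ((1 - X) ^ (-a)) := by
  have h := (Complex.one_div_one_sub_cpow_hasFPowerSeriesOnBall_zero a).hasSum (y := X)
    (by simpa [enorm_eq_nnnorm] using show ‖X‖₊ < 1 from hX)
  simpa only [FormalMultilinearSeries.ofScalars_apply_eq, smul_eq_mul, ← poch_div_factorial,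
    zero_add, one_div, ← Complex.cpow_neg] using h

theorem summable_norm_poch_div_factorial_mul_pow (a : ℂ) {σ : ℝ} (h0 : 0 ≤ σ) (h1 : σ < 1) :
    Summable fun j : ℕ => ‖poch a j / j.factorial‖ * σ ^ j := by
  have h := (hasSum_one_sub_cpow_neg a (X := σ) (by rwa [Complex.norm_real,
    Real.norm_of_nonneg h0])).summable.norm
  simpa only [norm_mul, norm_pow, Complex.norm_real, Real.norm_of_nonneg h0] using h

theorem fwdDiff_iter_one_sub_cpow_neg {X : ℂ} (hX : X ≠ 1) (k : ℕ) (a : ℂ) :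
    (fwdDiff 1)^[k] (fun z => (1 - X) ^ (-z)) a = (X / (1 - X)) ^ k * (1 - X) ^ (-a) := by
  have hX' : 1 - X ≠ 0 := sub_ne_zero.mpr hX.symm
  refine fwdDiff_iter_of_fwdDiff_eq_mul (fun z => ?_) k a
  rw [fwdDiff, neg_add', Complex.cpow_sub _ _ hX', Complex.cpow_one]
  field_simp
  ring

theorem norm_div_one_sub_le {κ : ℝ} {X : ℂ} (hX : ‖X‖ < 1) (hre : X.re ≤ κ) (hκ : κ < 1 / 2) :
    ‖X / (1 - X)‖ ≤ √((3 + 2 * κ) / 4) := by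
  have hpos : 0 < ‖1 - X‖ := norm_pos_iff.mpr fun h => by
    rw [← sub_eq_zero.mp h, norm_one] at hX
    exact hX.false
  have hle : ‖1 - X‖ ≤ 2 := (norm_sub_le _ _).trans (by rw [norm_one]; linarith)
  have hsq : ‖X‖ ^ 2 = ‖1 - X‖ ^ 2 - (1 - 2 * X.re) := by
    rw [Complex.sq_norm, Complex.sq_norm, Complex.normSq_apply, Complex.normSq_apply]
    simp only [Complex.sub_re, Complex.sub_im, Complex.one_re, Complex.one_im]
    ring
  rw [norm_div]
  refine Real.le_sqrt_of_sq_le ?_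
  rw [div_pow, div_le_iff₀ (by positivity), hsq]
  nlinarith [mul_le_mul hle hle hpos.le zero_le_two]

theorem exists_norm_one_sub_cpow_le (a : ℂ) {σ : ℝ} (hσ : σ < 1) :
    ∃ C, ∀ X : ℂ, ‖X‖ ≤ σ → ‖(1 - X) ^ a‖ ≤ C := by
  have hcont : ContinuousOn (fun X : ℂ => (1 - X) ^ a) (Metric.closedBall 0 σ) := by
    refine (continuousOn_const.sub continuousOn_id).cpow_const fun X hX => ?_
    rw [sub_eq_add_neg]
    exact Complex.mem_slitPlane_of_norm_lt_one
      (by simpa using (mem_closedBall_zero_iff.mp hX).trans_lt hσ)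
  obtain ⟨C, hC⟩ := (isCompact_closedBall (0 : ℂ) σ).exists_bound_of_continuousOn hcont
  exact ⟨C, fun X hX => hC X (mem_closedBall_zero_iff.mpr hX)⟩

section EulerIntegral

open MeasureTheory

theorem betaIntegral_add_natCast_div {b c : ℂ} (hb : 0 < b.re) (hc : 0 < (c - b).re) (m : ℕ) :
    Complex.betaIntegral (b + m) (c - b) / Complex.betaIntegral b (c - b)
      = poch b m / poch c m := by
  have hcpos : 0 < c.re := by
    rw [Complex.sub_re] at hc
    linarith
  have hbm : 0 < (b + m).re := by
    rw [Complex.add_re, Complex.natCast_re]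
    positivity
  have hcm : 0 < (c + m).re := by
    rw [Complex.add_re, Complex.natCast_re]
    positivity
  have hΓb := Complex.Gamma_ne_zero_of_re_pos hb
  have hΓc := Complex.Gamma_ne_zero_of_re_pos hcpos
  have hΓcb := Complex.Gamma_ne_zero_of_re_pos hc
  have hΓcm := Complex.Gamma_ne_zero_of_re_pos hcm
  rw [Complex.betaIntegral_eq_Gamma_mul_div _ _ hbm hc, Complex.betaIntegral_eq_Gamma_mul_div _ _ hb
    hc, poch_eq_Gamma b m (ne_neg_natCast_of_re_pos hb),
    poch_eq_Gamma c m (ne_neg_natCast_of_re_pos hcpos), add_sub_cancel, add_right_comm,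
    add_sub_cancel]
  field_simp

theorem exists_beta_moments {b c : ℂ} (hb : 0 < b.re) (hc : 0 < (c - b).re) :
    ∃ w : ℝ → ℂ, ∀ m : ℕ,
      Integrable (fun s => w s * (s : ℂ) ^ m) (volume.restrict (Set.Ioc 0 1)) ∧
      ∫ s in Set.Ioc (0 : ℝ) 1, w s * (s : ℂ) ^ m = poch b m / poch c m := by
  have hbm : ∀ m : ℕ, 0 < (b + m).re := fun m => by
    rw [Complex.add_re, Complex.natCast_re]
    positivity
  have hpow : ∀ m : ℕ, ∀ s ∈ Set.Ioc (0 : ℝ) 1,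
      (s : ℂ) ^ (b - 1) * (1 - (s : ℂ)) ^ (c - b - 1) * (s : ℂ) ^ m
      = (s : ℂ) ^ (b + m - 1) * (1 - (s : ℂ)) ^ (c - b - 1) := fun m s hs => by
    rw [add_sub_right_comm, Complex.cpow_add _ _ (Complex.ofReal_ne_zero.mpr hs.1.ne'),
      Complex.cpow_natCast]
    ring
  refine ⟨fun s => (Complex.betaIntegral b (c - b))⁻¹ *
    ((s : ℂ) ^ (b - 1) * (1 - (s : ℂ)) ^ (c - b - 1)), fun m => ⟨?_, ?_⟩⟩ <;>
    simp only [mul_assoc (Complex.betaIntegral b (c - b))⁻¹]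
  · have hconv := Complex.betaIntegral_convergent (hbm m) hc
    rw [intervalIntegrable_iff_integrableOn_Ioc_of_le zero_le_one] at hconv
    exact (hconv.congr_fun (fun s hs => (hpow m s hs).symm) measurableSet_Ioc).const_mul _
  · rw [integral_const_mul, setIntegral_congr_fun measurableSet_Ioc (hpow m),
      ← intervalIntegral.integral_of_le zero_le_one, ← Complex.betaIntegral, inv_mul_eq_div,
      betaIntegral_add_natCast_div hb hc]

/-- Lebesgue measure on the unit cube `(0, 1]^ι`, over which Euler integrals are taken. -/
noncomputable def cubeMeasure (ι : Type*) [Fintype ι] : Measure (ι → ℝ) :=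
  Measure.pi fun _ => volume.restrict (Set.Ioc 0 1)

variable {ι : Type*} [Fintype ι]

theorem ae_cubeMeasure_mem_Ioc : ∀ᵐ s ∂cubeMeasure ι, ∀ i, s i ∈ Set.Ioc (0 : ℝ) 1 := by
  rw [cubeMeasure, ← Measure.restrict_pi_pi]
  filter_upwards [ae_restrict_mem (.univ_pi fun _ => measurableSet_Ioc)] with s hs i
  exact hs i (Set.mem_univ i)

theorem exists_cube_moments {b c : ι → ℂ} (h : ∀ i, 0 < (b i).re ∧ 0 < (c i - b i).re) :
    ∃ w : (ι → ℝ) → ℂ, Integrable w (cubeMeasure ι) ∧ ∀ m : ι → ℕ,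
      ∫ s, w s * ∏ i, (s i : ℂ) ^ m i ∂cubeMeasure ι
        = ∏ i, poch (b i) (m i) / poch (c i) (m i) := by
  choose w hint hval using fun i => exists_beta_moments (h i).1 (h i).2
  refine ⟨fun s => ∏ i, w i (s i), ?_, fun m => ?_⟩
  · exact Integrable.fintype_prod fun i => by simpa using hint i 0
  · simp only [← prod_mul_distrib]
    rw [cubeMeasure, integral_fintype_prod_eq_prod (f := fun i t => w i t * (t : ℂ) ^ m i)]
    exact prod_congr rfl fun i _ => hval i (m i)

theorem norm_ofReal_mul_le {t : ℝ} (ht : t ∈ Set.Ioc 0 1) (z : ℂ) : ‖(t : ℂ) * z‖ ≤ ‖z‖ := by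
  rw [norm_mul, Complex.norm_real, Real.norm_of_nonneg ht.1.le]
  exact mul_le_of_le_one_left (norm_nonneg _) ht.2

section Cube

variable {s : ι → ℝ} (hs : ∀ i, s i ∈ Set.Ioc (0 : ℝ) 1) (x : ι → ℂ)
include hs

theorem norm_sum_ofReal_mul_le : ‖∑ i, (s i : ℂ) * x i‖ ≤ ∑ i, ‖x i‖ :=
  (norm_sum_le _ _).trans (sum_le_sum fun i _ => norm_ofReal_mul_le (hs i) (x i))

theorem re_sum_ofReal_mul_le : (∑ i, (s i : ℂ) * x i).re ≤ ∑ i, max (x i).re 0 := by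
  rw [Complex.re_sum]
  refine sum_le_sum fun i _ => ?_
  rw [Complex.re_ofReal_mul]
  rcases le_total (x i).re 0 with h | h
  · exact (mul_nonpos_of_nonneg_of_nonpos (hs i).1.le h).trans (le_max_right _ _)
  · exact (mul_le_of_le_one_left h (hs i).2).trans (le_max_left _ _)

end Cube

theorem hasSum_one_sub_sum_cpow_neg (a : ℂ) {r : ι → ℂ} (hr : ∑ i, ‖r i‖ < 1) :
    HasSum (fun m : ι → ℕ => poch a (∑ i, m i) * ∏ i, (r i ^ m i / (m i).factorial))
      ((1 - ∑ i, r i) ^ (-a)) := by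
  classical
  have h := hasSum_mul_factorial_mul_prod
    (summable_norm_poch_div_factorial_mul_pow a (sum_nonneg fun i _ => norm_nonneg (r i)) hr)
    (hasSum_one_sub_cpow_neg a ((norm_sum_le _ _).trans_lt hr))
  refine h.congr_fun fun m => ?_
  rw [← mul_assoc, div_mul_cancel₀ _ (Nat.cast_ne_zero.mpr (Nat.factorial_ne_zero _))]

theorem integrable_mul_one_sub_sum_cpow {w : (ι → ℝ) → ℂ} (hw : Integrable w (cubeMeasure ι))
    {x : ι → ℂ} (hx : ∑ i, ‖x i‖ < 1) (a : ℂ) :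
    Integrable (fun s => w s * (1 - ∑ i, (s i : ℂ) * x i) ^ a) (cubeMeasure ι) := by
  obtain ⟨C, hC⟩ := exists_norm_one_sub_cpow_le a hx
  refine hw.mul_bdd (c := C) (Measurable.aestronglyMeasurable (by fun_prop)) ?_
  filter_upwards [ae_cubeMeasure_mem_Ioc] with s hs
  exact hC _ (norm_sum_ofReal_mul_le hs x)

theorem lauricellaA_eq_integral {n : ℕ} {b c : Fin n → ℂ} {w : (Fin n → ℝ) → ℂ}
    (hw : Integrable w (cubeMeasure (Fin n)))
    (hmoments : ∀ m : Fin n → ℕ, ∫ s, w s * ∏ i, (s i : ℂ) ^ m i ∂cubeMeasure (Fin n)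
      = ∏ i, poch (b i) (m i) / poch (c i) (m i)) {x : Fin n → ℂ} (hx : ∑ i, ‖x i‖ < 1) (a : ℂ) :
    lauricellaA a b c x
      = ∫ s, w s * (1 - ∑ i, (s i : ℂ) * x i) ^ (-a) ∂cubeMeasure (Fin n) := by
  let K : (Fin n → ℂ) → (Fin n → ℕ) → ℂ := fun r m =>
    poch a (∑ i, m i) * ∏ i, (r i ^ m i / (m i).factorial)
  have hfactor : ∀ s : Fin n → ℝ, ∀ m,
      w s * K (fun i => s i * x i) m = K x m * (w s * ∏ i, (s i : ℂ) ^ m i) := fun s m => by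
    simp only [K, mul_pow, prod_div_distrib, prod_mul_distrib]
    ring
  have hterm : ∀ m, ∫ s, w s * K (fun i => s i * x i) m ∂cubeMeasure (Fin n)
      = lauricellaATerm a b c x m := fun m => by
    simp only [hfactor, integral_const_mul, hmoments, K, lauricellaATerm, mul_assoc,
      ← prod_mul_distrib]
    exact congrArg _ (prod_congr rfl fun i _ => by ring)
  have hbound : ∀ m, ∀ᵐ s ∂cubeMeasure (Fin n),
      ‖w s * K (fun i => s i * x i) m‖ ≤ ‖w s‖ * ‖K x m‖ := fun m => by
    filter_upwards [ae_cubeMeasure_mem_Ioc] with s hs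
    simp only [K, norm_mul, norm_prod, norm_div, norm_pow]
    gcongr with i
    simpa only [norm_mul] using norm_ofReal_mul_le (hs i) (x i)
  have hK : Summable (K x) := (hasSum_one_sub_sum_cpow_neg a hx).summable
  have hsum := hasSum_integral_of_dominated_convergence
    (F := fun m s => w s * K (fun i => s i * x i) m) (fun m s => ‖w s‖ * ‖K x m‖)
    (fun m => hw.1.mul (Measurable.aestronglyMeasurable (by fun_prop))) hbound
    (.of_forall fun s => hK.norm.mul_left _)
    (by simpa only [tsum_mul_left] using hw.norm.mul_const _)
    (by
      filter_upwards [ae_cubeMeasure_mem_Ioc] with s hs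
      exact (hasSum_one_sub_sum_cpow_neg a
        ((sum_le_sum fun i _ => norm_ofReal_mul_le (hs i) (x i)).trans_lt hx)).mul_left (w s))
  simpa only [hterm, lauricellaA] using hsum.tsum_eq

theorem hasGeometricDifferences_lauricellaA_of_re_pos {n : ℕ} {b c x : Fin n → ℂ}
    (h : ∀ i, 0 < (b i).re ∧ 0 < (c i - b i).re) (hx : ∑ i, ‖x i‖ < 1)
    (hx' : ∑ i, max (x i).re 0 < 1 / 2) : HasGeometricDifferences fun z => lauricellaA z b c x := by
  intro a
  obtain ⟨w, hw, hmoments⟩ := exists_cube_moments h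
  set κ := ∑ i, max (x i).re 0
  have hκ : 0 ≤ κ := sum_nonneg fun i _ => le_max_right _ _
  have hdiff : ∀ k, (fwdDiff 1)^[k] (fun z => lauricellaA z b c x) a = ∫ s,
      (fwdDiff 1)^[k] (fun z => w s * (1 - ∑ i, (s i : ℂ) * x i) ^ (-z)) a ∂cubeMeasure (Fin n) :=
    fun k => by
    simp only [lauricellaA_eq_integral hw hmoments hx]
    exact fwdDiff_iter_integral (fun z => integrable_mul_one_sub_sum_cpow hw hx (-z)) 1 k a
  obtain ⟨C, hC⟩ := exists_norm_one_sub_cpow_le (-a) hx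
  refine ⟨√((3 + 2 * κ) / 4), ⟨by positivity, (Real.sqrt_lt' one_pos).mpr (by linarith)⟩,
    .of_bound ((∫ s, ‖w s‖ ∂cubeMeasure (Fin n)) * C) (.of_forall fun k => ?_)⟩
  rw [hdiff, Real.norm_of_nonneg (by positivity), mul_assoc, ← integral_mul_const]
  refine norm_integral_le_of_norm_le (hw.norm.mul_const _) ?_
  filter_upwards [ae_cubeMeasure_mem_Ioc] with s hs
  have hX : ‖∑ i, (s i : ℂ) * x i‖ < 1 := (norm_sum_ofReal_mul_le hs x).trans_lt hx
  have hsmul : (fun z : ℂ => w s * (1 - ∑ i, (s i : ℂ) * x i) ^ (-z))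
      = w s • fun z : ℂ => (1 - ∑ i, (s i : ℂ) * x i) ^ (-z) := rfl
  rw [hsmul, fwdDiff_iter_const_smul, Pi.smul_apply, smul_eq_mul, fwdDiff_iter_one_sub_cpow_neg
    (fun h => by simp [h] at hX), norm_mul, norm_mul, norm_pow, mul_comm (_ ^ k)]
  have hC := hC _ (norm_sum_ofReal_mul_le hs x)
  gcongr
  · exact (norm_nonneg _).trans hC
  · exact norm_div_one_sub_le hX (re_sum_ofReal_mul_le hs x) hx'

end EulerIntegral

theorem hasGeometricDifferences_lauricellaA {n : ℕ} (b : Fin n → ℂ) {c x : Fin n → ℂ}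
    (hc : ∀ i, ∀ m : ℕ, c i ≠ -m) (hx : ∑ i, ‖x i‖ < 1) (hx' : ∑ i, max (x i).re 0 < 1 / 2) :
    HasGeometricDifferences fun z => lauricellaA z b c x := by
  refine forall_pi_of_re_pos_of_contiguous
    (P := fun b c => HasGeometricDifferences fun z => lauricellaA z b c x)
    (fun b c h => hasGeometricDifferences_lauricellaA_of_re_pos h hx hx')
    (fun i b c hc h₁ h₂ => ?_) (fun i b c hc h₁ h₂ => ?_) b c hc
  · rw [funext (lauricellaA_eq_sub hc hx i)]
    exact h₁.add (h₂.self_mul_comp_add_one.const_smul _)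
  · rw [funext (lauricellaA_eq_add hc hx i)]
    exact h₁.add (h₂.self_mul_comp_add_one.const_smul _)

theorem hasSum_lauricellaA_sub_mul_zeroFTerm {n p : ℕ} {a : ℂ} (ha : ∀ m : ℕ, a ≠ m + 1)
    (b : Fin n → ℂ) {c x : Fin n → ℂ} (hc : ∀ i, ∀ m : ℕ, c i ≠ -m) (hx : ∑ i, ‖x i‖ < 1)
    (y : Fin p → ℂ) :
    HasSum (fun q => lauricellaA (a - (∑ j, q j : ℕ)) b c x * zeroFTerm (1 - a) (-y) q)
      (confluentHA a b c x y) := by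
  have hswap := (Equiv.prodComm (Fin p → ℕ) (Fin n → ℕ)).hasSum_iff.mpr
    (summable_confluentHATerm ha b hc hx y).hasSum
  refine hswap.prod_fiberwise fun q => ?_
  simp only [Function.comp_def, Equiv.prodComm_apply, Prod.swap_prod_mk, confluentHATerm_eq ha]
  exact (summable_lauricellaATerm _ b hc hx).hasSum.mul_right _

/-- By `multichoose_mul_pow_le` the coefficients of Newton's formula grow at most like
`(1 - z)^{-|q|}` for any `z ∈ (θ, 1)`, which is harmless against the entire function `₀F_p`. -/
theorem HasGeometricDifferences.summable_fwdDiff_iter_mul_zeroFTerm {p : ℕ} {f : ℂ → ℂ}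
    (hf : HasGeometricDifferences f) (a : ℂ) {d : ℂ} (hd : ∀ m : ℕ, d ≠ -m) (y : Fin p → ℂ) :
    Summable fun kq : ℕ × (Fin p → ℕ) => (-1) ^ kq.1 * (fwdDiff 1)^[kq.1] f a *
      (((∑ j, kq.2 j).multichoose kq.1 : ℂ) * zeroFTerm d y kq.2) := by
  obtain ⟨C, θ, hC, hθ, hθ1, hbound⟩ := hf.exists_norm_le a
  obtain ⟨z, hθz, hz1⟩ := exists_between hθ1
  have hz : 0 < z := hθ.trans hθz
  have hz' : 0 < 1 - z := sub_pos.mpr hz1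
  have hgeom := (summable_geometric_of_lt_one (by positivity) ((div_lt_one hz).mpr hθz)).mul_left C
  have hexp := summable_pow_mul_zeroFTerm hd y (inv_nonneg.mpr hz'.le)
  refine .of_norm_bounded (hgeom.mul_of_nonneg hexp
    (fun k => mul_nonneg hC (by positivity)) fun q => by positivity) ?_
  rintro ⟨k, q⟩
  simp only [norm_mul, norm_pow, norm_neg, norm_one, one_pow, one_mul, Complex.norm_natCast]
  calc ‖(fwdDiff 1)^[k] f a‖ * (((∑ j, q j).multichoose k : ℝ) * ‖zeroFTerm d y q‖)
      ≤ C * θ ^ k * (((∑ j, q j).multichoose k : ℝ) * ‖zeroFTerm d y q‖) := by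
        gcongr
        exact hbound k
    _ = C * ((((∑ j, q j).multichoose k : ℝ) * θ ^ k) * ‖zeroFTerm d y q‖) := by ring
    _ ≤ C * (((1 - z)⁻¹ ^ (∑ j, q j) * (θ / z) ^ k) * ‖zeroFTerm d y q‖) := by
        gcongr C * (?_ * _)
        exact multichoose_mul_pow_le hθ.le hz hz1 (∑ j, q j) k
    _ = C * (θ / z) ^ k * ((1 - z)⁻¹ ^ (∑ j, q j) * ‖zeroFTerm d y q‖) := by ring

theorem HasGeometricDifferences.hasSum_tsum_multichoose_mul_zeroFTerm {p : ℕ} {f : ℂ → ℂ}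
    (hf : HasGeometricDifferences f) (a : ℂ) {d : ℂ} (hd : ∀ m : ℕ, d ≠ -m) (y : Fin p → ℂ) :
    HasSum (fun k : ℕ => (-1) ^ k * (fwdDiff 1)^[k] f a *
      ∑' q : Fin p → ℕ, ((∑ j, q j).multichoose k : ℂ) * zeroFTerm d y q)
      (∑' q : Fin p → ℕ, f (a - (∑ j, q j : ℕ)) * zeroFTerm d y q) := by
  have hG := hf.summable_fwdDiff_iter_mul_zeroFTerm a hd y
  have hnewton : ∀ q : Fin p → ℕ, HasSum
      (fun k => (-1) ^ k * (fwdDiff 1)^[k] f a *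
        (((∑ j, q j).multichoose k : ℂ) * zeroFTerm d y q))
      (f (a - (∑ j, q j : ℕ)) * zeroFTerm d y q) := fun q => by
    refine ((hf.hasSum_sub_natCast a (∑ j, q j)).mul_right (zeroFTerm d y q)).congr_fun
      fun k => ?_
    ring
  have htsum : ∀ k : ℕ, HasSum
      (fun q : Fin p → ℕ => (-1) ^ k * (fwdDiff 1)^[k] f a *
        (((∑ j, q j).multichoose k : ℂ) * zeroFTerm d y q))
      ((-1) ^ k * (fwdDiff 1)^[k] f a *
        ∑' q : Fin p → ℕ, ((∑ j, q j).multichoose k : ℂ) * zeroFTerm d y q) := fun k =>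
    (summable_multichoose_mul_zeroFTerm hd y k).hasSum.mul_left _
  have hswap := (Equiv.prodComm (Fin p → ℕ) ℕ).hasSum_iff.mpr hG.hasSum
  rw [(hswap.prod_fiberwise hnewton).tsum_eq]
  exact hG.hasSum.prod_fiberwise htsum

theorem hasSum_confluentHA {n p : ℕ} {a : ℂ} (ha : ∀ m : ℕ, a ≠ m + 1) (b : Fin n → ℂ)
    {c x : Fin n → ℂ} (hc : ∀ i, ∀ m : ℕ, c i ≠ -m) (hx : ∑ i, ‖x i‖ < 1)
    (hx' : ∑ i, max (x i).re 0 < 1 / 2) (y : Fin p → ℂ) :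
    HasSum (fun k : ℕ => (-1) ^ k * (fwdDiff 1)^[k] (fun z => lauricellaA z b c x) a *
      ∑' q : Fin p → ℕ, ((∑ j, q j).multichoose k : ℂ) * zeroFTerm (1 - a) (-y) q)
      (confluentHA a b c x y) := by
  rw [← (hasSum_lauricellaA_sub_mul_zeroFTerm ha b hc hx y).tsum_eq]
  exact (hasGeometricDifferences_lauricellaA b hc hx hx').hasSum_tsum_multichoose_mul_zeroFTerm a
    (one_sub_ne_neg_natCast ha) (-y)

/-! ### The terms of the decompositions -/

section Choose

variable {ι : Type*}

theorem sum_piAntidiag_prod_choose [DecidableEq ι] (s : Finset ι) (m : ι → ℕ) (k : ℕ) :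
    ∑ j ∈ piAntidiag s k, ∏ i ∈ s, (m i).choose (j i) = (∑ i ∈ s, m i).choose k := by
  induction s using Finset.cons_induction generalizing k with
  | empty => cases k <;> simp
  | cons a s has ih =>
    rw [sum_cons, piAntidiag_cons, sum_disjiUnion, Nat.add_choose_eq]
    refine sum_congr rfl fun p _ => ?_
    rw [sum_map, ← ih, mul_sum]
    refine sum_congr rfl fun f hf => ?_
    have hfa : f a = 0 := by
      by_contra h
      exact has ((mem_piAntidiag.mp hf).2 a h)
    rw [prod_cons]
    congr 1
    · simp [hfa]
    · refine prod_congr rfl fun i hi => ?_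
      have hne : i ≠ a := fun h => has (h ▸ hi)
      simp [hne]

theorem tsum_comp_add_right_of_not_le {α : Type*} [AddCommMonoid α] [TopologicalSpace α]
    {u : (ι → ℕ) → α} {j : ι → ℕ} (hu : ∀ m, ¬ j ≤ m → u m = 0) :
    ∑' m, u (m + j) = ∑' m, u m :=
  (add_left_injective j).tsum_eq <| Function.support_subset_iff'.mpr fun m hm =>
    hu m fun hjm => hm ⟨m - j, tsub_add_cancel_of_le hjm⟩

variable [Fintype ι]

theorem summable_prod_choose_mul {k : ℕ} {u : (ι → ℕ) → ℂ}
    (hu : Summable fun m => ((∑ i, m i).choose k : ℂ) * u m) {j : ι → ℕ} (hj : ∑ i, j i = k) :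
    Summable fun m => (∏ i, ((m i).choose (j i) : ℂ)) * u m := by
  classical
  refine .of_norm_bounded hu.norm fun m => ?_
  have hle : ∏ i, (m i).choose (j i) ≤ (∑ i, m i).choose k := by
    rw [← sum_piAntidiag_prod_choose]
    exact single_le_sum (f := fun j : ι → ℕ => ∏ i, (m i).choose (j i))
      (fun _ _ => Nat.zero_le _) (by simp [hj])
  rw [norm_mul, norm_mul, Complex.norm_natCast, ← Nat.cast_prod, Complex.norm_natCast]
  gcongr

theorem tsum_choose_mul [DecidableEq ι] (k : ℕ) {u : (ι → ℕ) → ℂ}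
    (hu : Summable fun m => ((∑ i, m i).choose k : ℂ) * u m) :
    ∑' m, ((∑ i, m i).choose k : ℂ) * u m
      = ∑ j ∈ piAntidiag univ k, ∑' m, (∏ i, ((m i + j i).choose (j i) : ℂ)) * u (m + j) := by
  have hchoose : ∀ m : ι → ℕ, ((∑ i, m i).choose k : ℂ)
      = ∑ j ∈ piAntidiag univ k, ∏ i, ((m i).choose (j i) : ℂ) := fun m => by
    exact_mod_cast (sum_piAntidiag_prod_choose univ m k).symm
  calc ∑' m, ((∑ i, m i).choose k : ℂ) * u m
      = ∑' m, ∑ j ∈ piAntidiag univ k, (∏ i, ((m i).choose (j i) : ℂ)) * u m := by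
        simp only [hchoose, sum_mul]
    _ = ∑ j ∈ piAntidiag univ k, ∑' m, (∏ i, ((m i).choose (j i) : ℂ)) * u m :=
        Summable.tsum_finsetSum fun j hj =>
          summable_prod_choose_mul hu (mem_piAntidiag.mp hj).1
    _ = _ := by
        refine sum_congr rfl fun j _ => (tsum_comp_add_right_of_not_le fun m hm => ?_).symm
        obtain ⟨i, hi⟩ : ∃ i, m i < j i := by simpa [Pi.le_def] using hm
        rw [prod_eq_zero (mem_univ i) (by simp [Nat.choose_eq_zero_of_lt hi]), zero_mul]

end Choose

theorem choose_mul_pow_div_factorial {K : Type*} [Field K] [CharZero K] (x : K) (m j : ℕ) :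
    ((m + j).choose j : K) * (x ^ (m + j) / (m + j).factorial)
      = x ^ j / j.factorial * (x ^ m / m.factorial) := by
  rw [add_comm m j, Nat.cast_add_choose, pow_add]
  have hne : ((j + m).factorial : K) ≠ 0 := Nat.cast_ne_zero.mpr (Nat.factorial_ne_zero _)
  field_simp

theorem kummerTerm_eq_div_mul (b c x : ℂ) (m : ℕ) :
    kummerTerm b c x m = poch b m / poch c m * (x ^ m / m.factorial) := by
  rw [kummerTerm]
  ring

theorem choose_mul_kummerTerm (b c x : ℂ) (m j : ℕ) :
    ((m + j).choose j : ℂ) * kummerTerm b c x (m + j)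
      = kummerTerm b c x j * kummerTerm (b + j) (c + j) x m := by
  rw [kummerTerm_eq_div_mul, mul_left_comm, choose_mul_pow_div_factorial,
    kummerTerm_eq_div_mul, kummerTerm_eq_div_mul, add_comm m j, poch_add, poch_add]
  ring

theorem fwdDiff_iter_lauricellaATerm {n : ℕ} (a : ℂ) (b c x : Fin n → ℂ) (m : Fin n → ℕ) (k : ℕ) :
    (fwdDiff 1)^[k] (fun z => lauricellaATerm z b c x m) a
      = ((∑ i, m i).choose k : ℂ) * (k.factorial * poch (a + k) (∑ i, m i - k) *
        ∏ i, kummerTerm (b i) (c i) (x i) (m i)) := by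
  have hsmul : (fun z => lauricellaATerm z b c x m)
      = (∏ i, kummerTerm (b i) (c i) (x i) (m i)) • fun z => poch z (∑ i, m i) := by
    ext z
    rw [lauricellaATerm_eq, Pi.smul_apply, smul_eq_mul, mul_comm]
  rw [hsmul, fwdDiff_iter_const_smul, Pi.smul_apply, smul_eq_mul, fwdDiff_iter_poch,
    Nat.descFactorial_eq_factorial_mul_choose]
  push_cast
  ring

theorem fwdDiff_iter_lauricellaA {n : ℕ} (a : ℂ) (b : Fin n → ℂ) {c x : Fin n → ℂ}
    (hc : ∀ i, ∀ m : ℕ, c i ≠ -m) (hx : ∑ i, ‖x i‖ < 1) (k : ℕ) :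
    (fwdDiff 1)^[k] (fun z => lauricellaA z b c x) a
      = ∑ j ∈ piAntidiag univ k, (k.factorial : ℂ) *
        (∏ i, kummerTerm (b i) (c i) (x i) (j i)) *
        lauricellaA (a + k) (fun s => b s + j s) (fun s => c s + j s) x := by
  have hsum := hasSum_fwdDiff_iter
    (fun z => (summable_lauricellaATerm z b hc hx).hasSum) 1 k a
  simp only [fwdDiff_iter_lauricellaATerm] at hsum
  refine hsum.tsum_eq.symm.trans ?_
  rw [tsum_choose_mul k hsum.summable]
  refine sum_congr rfl fun j hj => ?_
  have hdegree : ∀ m : Fin n → ℕ, ∑ i, (m + j) i - k = ∑ i, m i := fun m => by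
    simp [sum_add_distrib, (mem_piAntidiag.mp hj).1]
  have hprod : ∀ m : Fin n → ℕ,
      (∏ i, ((m i + j i).choose (j i) : ℂ)) * ∏ i, kummerTerm (b i) (c i) (x i) ((m + j) i)
        = (∏ i, kummerTerm (b i) (c i) (x i) (j i)) *
          ∏ i, kummerTerm (b i + j i) (c i + j i) (x i) (m i) := fun m => by
    simp only [← prod_mul_distrib, Pi.add_apply, choose_mul_kummerTerm]
  rw [lauricellaA, ← tsum_mul_left]
  refine tsum_congr fun m => ?_
  rw [hdegree, lauricellaATerm_eq]
  linear_combination (k.factorial : ℂ) * poch (a + k) (∑ i, m i) * hprod m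

theorem summable_choose_mul_zeroFTerm {p : ℕ} {d : ℂ} (hd : ∀ m : ℕ, d ≠ -m) (y : Fin p → ℂ)
    (l : ℕ) : Summable fun q : Fin p → ℕ => ((∑ j, q j).choose l : ℂ) * zeroFTerm d y q := by
  refine .of_norm_bounded (summable_pow_mul_zeroFTerm hd y zero_le_two) fun q => ?_
  rw [norm_mul, Complex.norm_natCast]
  gcongr
  exact_mod_cast Nat.choose_le_two_pow _ _

theorem tsum_choose_mul_zeroFTerm {p : ℕ} {d : ℂ} (hd : ∀ m : ℕ, d ≠ -m) (y : Fin p → ℂ) (l : ℕ) :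
    ∑' q : Fin p → ℕ, ((∑ j, q j).choose l : ℂ) * zeroFTerm d y q
      = ∑ j ∈ piAntidiag univ l, zeroFTerm d y j * zeroF (d + l) y := by
  rw [tsum_choose_mul l (summable_choose_mul_zeroFTerm hd y l)]
  refine sum_congr rfl fun j hj => ?_
  have hj : ∑ i, j i = l := (mem_piAntidiag.mp hj).1
  have hdegree : ∀ q : Fin p → ℕ, ∑ i, (q + j) i = l + ∑ i, q i := fun q => by
    simp [sum_add_distrib, hj, add_comm]
  have hprod : ∀ q : Fin p → ℕ, (∏ i, ((q i + j i).choose (j i) : ℂ)) *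
      ∏ i, (y i ^ (q + j) i / (((q + j) i).factorial : ℂ))
        = (∏ t, (y t ^ j t / ((j t).factorial : ℂ))) *
          ∏ t, (y t ^ q t / ((q t).factorial : ℂ)) := fun q => by
    simp only [← prod_mul_distrib, Pi.add_apply, choose_mul_pow_div_factorial]
  rw [zeroF, ← tsum_mul_left]
  refine tsum_congr fun q => ?_
  rw [zeroFTerm, zeroFTerm, zeroFTerm, hdegree, hj, poch_add, mul_inv]
  linear_combination (poch d l)⁻¹ * (poch (d + l) (∑ i, q i))⁻¹ * hprod q

theorem multichoose_succ_eq_sum (Q k : ℕ) :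
    Q.multichoose (k + 1) = ∑ l ∈ Icc 1 (k + 1), k.choose (l - 1) * Q.choose l := by
  have hI : Icc 1 (k + 1) = Ico (0 + 1) (k + 1 + 1) := by ext; simp
  rw [hI, ← sum_Ico_add' (fun l => k.choose (l - 1) * Q.choose l), ← range_eq_Ico,
    Nat.multichoose_eq, show Q + (k + 1) - 1 = Q + k by omega, Nat.add_choose_eq,
    Nat.sum_antidiagonal_eq_sum_range_succ (fun i j => Q.choose i * k.choose j),
    sum_range_succ']
  simp only [Nat.sub_zero, Nat.choose_succ_self, mul_zero, add_zero, Nat.add_sub_cancel]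
  refine sum_congr rfl fun i hi => ?_
  rw [show k + 1 - (i + 1) = k - i by omega,
    Nat.choose_symm (Nat.lt_succ_iff.mp (mem_range.mp hi)), mul_comm]

theorem tsum_multichoose_succ_mul_zeroFTerm {p : ℕ} {d : ℂ} (hd : ∀ m : ℕ, d ≠ -m)
    (y : Fin p → ℂ) (k : ℕ) :
    ∑' q : Fin p → ℕ, ((∑ j, q j).multichoose (k + 1) : ℂ) * zeroFTerm d y q
      = ∑ l ∈ Icc 1 (k + 1), ∑ j ∈ piAntidiag univ l,
        (k.choose (l - 1) : ℂ) * (zeroFTerm d y j * zeroF (d + l) y) := by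
  calc ∑' q : Fin p → ℕ, ((∑ j, q j).multichoose (k + 1) : ℂ) * zeroFTerm d y q
      = ∑' q : Fin p → ℕ, ∑ l ∈ Icc 1 (k + 1),
          (k.choose (l - 1) : ℂ) * (((∑ j, q j).choose l : ℂ) * zeroFTerm d y q) := by
        simp only [multichoose_succ_eq_sum, Nat.cast_sum, Nat.cast_mul, sum_mul, mul_assoc]
    _ = ∑ l ∈ Icc 1 (k + 1), (k.choose (l - 1) : ℂ) *
          ∑' q : Fin p → ℕ, ((∑ j, q j).choose l : ℂ) * zeroFTerm d y q := by
        simp only [← tsum_mul_left]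
        exact Summable.tsum_finsetSum fun l _ =>
          (summable_choose_mul_zeroFTerm hd y l).mul_left _
    _ = _ := by simp only [tsum_choose_mul_zeroFTerm hd, mul_sum]

theorem decompTerm_succ {n p : ℕ} {a : ℂ} (ha : ∀ m : ℕ, a ≠ m + 1) (b : Fin n → ℂ)
    {c x : Fin n → ℂ} (hc : ∀ i, ∀ m : ℕ, c i ≠ -m) (hx : ∑ i, ‖x i‖ < 1) (y : Fin p → ℂ)
    (k : ℕ) :
    decompTerm a b c x y (k + 1)
      = (-1) ^ (k + 1) * (fwdDiff 1)^[k + 1] (fun z => lauricellaA z b c x) a *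
        ∑' q : Fin p → ℕ, ((∑ j, q j).multichoose (k + 1) : ℂ) * zeroFTerm (1 - a) (-y) q := by
  rw [tsum_multichoose_succ_mul_zeroFTerm (one_sub_ne_neg_natCast ha),
    fwdDiff_iter_lauricellaA a b hc hx, decompTerm, mul_sum]
  refine sum_congr rfl fun l _ => ?_
  rw [mul_sum]
  refine sum_comm.trans (sum_congr rfl fun j hj => ?_)
  rw [mul_sum, sum_mul]
  refine sum_congr rfl fun i _ => ?_
  have hj : ∑ t, j t = l := (mem_piAntidiag.mp hj).1
  have hkummer : ∏ s, kummerTerm (b s) (c s) (x s) (i s)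
      = (∏ s, poch (b s) (i s)) / (∏ s, poch (c s) (i s)) *
        ∏ s, (x s ^ i s / ((i s).factorial : ℂ)) := by
    simp only [kummerTerm_eq_div_mul, prod_mul_distrib, prod_div_distrib]
  have hsign : ∏ t, ((-y) t ^ j t / ((j t).factorial : ℂ))
      = (-1) ^ l * ∏ t, (y t ^ j t / ((j t).factorial : ℂ)) := by
    rw [← hj, ← prod_pow_eq_pow_sum, ← prod_mul_distrib]
    exact prod_congr rfl fun t _ => by rw [Pi.neg_apply, neg_pow, mul_div_assoc]
  rw [hkummer, zeroFTerm, hsign, hj, Nat.add_sub_cancel, pow_add (-1 : ℂ) (k + 1) l]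
  ring

theorem zeroFTerm_const (d y : ℂ) (q : ℕ) :
    zeroFTerm d (fun _ : Fin 1 => y) (fun _ => q) = zeroF1Term d y q := by
  simp only [zeroFTerm, zeroF1Term, Fin.sum_univ_one, Fin.prod_univ_one]
  ring

theorem summable_zeroF1Term {d : ℂ} (hd : ∀ m : ℕ, d ≠ -m) (y : ℂ) :
    Summable (zeroF1Term d y) := by
  have h := summable_zeroFTerm hd fun _ : Fin 1 => y
  rw [← (Equiv.funUnique (Fin 1) ℕ).symm.summable_iff] at h
  exact h.congr fun q => zeroFTerm_const d y q

theorem zeroF_const (d y : ℂ) : zeroF d (fun _ : Fin 1 => y) = zeroF1 d y := by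
  rw [zeroF, zeroF1, ← (Equiv.funUnique (Fin 1) ℕ).symm.tsum_eq]
  exact tsum_congr fun q => zeroFTerm_const d y q

theorem decompTermOne_eq {n : ℕ} (a : ℂ) (b c x : Fin n → ℂ) (y : ℂ) (k : ℕ) :
    decompTermOne a b c x y k = decompTerm a b c x (fun _ : Fin 1 => y) k := by
  have hsingleton : ∀ l : ℕ, piAntidiag (univ : Finset (Fin 1)) l = {fun _ => l} := fun l => by
    ext f
    simp [funext_iff, Fin.forall_fin_one]
  have hneg : -(fun _ : Fin 1 => y) = fun _ => -y := rfl
  simp only [decompTermOne, decompTerm, hsingleton, sum_singleton, hneg, zeroF_const, prod_const,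
    card_univ, Fintype.card_fin, pow_one]

/-! ### Euler operators and power series -/

section EulerOperator

theorem exists_one_lt_ofReal_mul_mem {U : Set ℂ} (hU : IsOpen U) {z : ℂ} (hz : z ∈ U) :
    ∃ r : ℝ, 1 < r ∧ r * z ∈ U := by
  have hcont : Tendsto (fun r : ℝ => r * z) (𝓝 1) (𝓝 z) := by
    have : ContinuousAt (fun r : ℝ => r * z) 1 := by fun_prop
    simpa [ContinuousAt] using this
  have hmem : ∀ᶠ r : ℝ in 𝓝[>] 1, r * z ∈ U :=
    (hcont.eventually (hU.mem_nhds hz)).filter_mono nhdsWithin_le_nhds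
  have hgt : ∀ᶠ r : ℝ in 𝓝[>] 1, 1 < r := self_mem_nhdsWithin
  exact (hgt.and hmem).exists

/-- The series converges absolutely at some `w ∈ U` with `|z| < |w|`, which allows termwise
differentiation in the disc of radius `|w|`. -/
theorem hasSum_natCast_mul_of_hasSum_mul_pow {α : Type*} {A : α → ℂ} {e : α → ℕ} {f : ℂ → ℂ}
    {U : Set ℂ} (hU : IsOpen U) (hf : ∀ t ∈ U, HasSum (fun m => A m * t ^ e m) (f t)) {z : ℂ}
    (hz : z ∈ U) : HasSum (fun m => (e m : ℂ) * (A m * z ^ e m)) (z * deriv f z) := by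
  rcases eq_or_ne z 0 with rfl | hz0
  · have hzero : ∀ m, (e m : ℂ) * (A m * 0 ^ e m) = 0 := fun m => by
      rcases eq_or_ne (e m) 0 with h | h <;> simp [h]
    simpa only [hzero, zero_mul] using hasSum_zero
  obtain ⟨r, hr, hw⟩ := exists_one_lt_ofReal_mul_mem hU hz
  have hzw : ‖z‖ < ‖(r : ℂ) * z‖ := by
    rw [norm_mul, Complex.norm_real, Real.norm_of_nonneg (by positivity)]
    exact lt_mul_of_one_lt_left (norm_pos_iff.mpr hz0) hr
  have hderiv := Complex.hasSum_deriv_of_summable_norm (F := fun m t => A m * t ^ e m)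
    (hf _ hw).summable.norm (fun m => by fun_prop) Metric.isOpen_ball
    (fun m t ht => by
      rw [norm_mul, norm_mul (A m), norm_pow, norm_pow]
      gcongr
      exact (mem_ball_zero_iff.mp ht).le)
    (mem_ball_zero_iff.mpr hzw)
  have hlocal : deriv f z = deriv (fun t => ∑' m, A m * t ^ e m) z :=
    EventuallyEq.deriv_eq <| by
      filter_upwards [hU.mem_nhds hz] with t ht using (hf t ht).tsum_eq.symm
  rw [hlocal]
  refine (hderiv.mul_left z).congr_fun fun m => ?_
  rw [deriv_const_mul_field, deriv_pow_field]
  rcases Nat.eq_zero_or_eq_succ_pred (e m) with h | h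
  · simp [h]
  · rw [h, Nat.succ_eq_add_one, Nat.add_sub_cancel, pow_succ]
    ring

variable {ι : Type*} [Fintype ι] [DecidableEq ι]

theorem prod_update_pow {R : Type*} [CommMonoid R] (z : ι → R) (i : ι) (t : R) (m : ι → ℕ) :
    ∏ j, update z i t j ^ m j = t ^ m i * ∏ j ∈ univ.erase i, z j ^ m j := by
  rw [← mul_prod_erase univ _ (mem_univ i), Function.update_self]
  refine congrArg _ (prod_congr rfl fun j hj => ?_)
  rw [Function.update_of_ne (mem_erase.mp hj).1]

theorem hasSum_sum_mul_deriv_update {α : Type*} {A : α → ℂ} {e : α → ι → ℕ} {f : (ι → ℂ) → ℂ}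
    {U : Set (ι → ℂ)} (hU : IsOpen U)
    (hf : ∀ z ∈ U, HasSum (fun m => A m * ∏ i, z i ^ e m i) (f z)) {z : ι → ℂ} (hz : z ∈ U) :
    HasSum (fun m => ((∑ i, e m i : ℕ) : ℂ) * (A m * ∏ i, z i ^ e m i))
      (∑ i, z i * deriv (fun t => f (update z i t)) (z i)) := by
  have hpartial : ∀ i, HasSum (fun m => (e m i : ℂ) * (A m * ∏ i, z i ^ e m i))
      (z i * deriv (fun t => f (update z i t)) (z i)) := fun i => by
    have hline : IsOpen (update z i ⁻¹' U) :=
      hU.preimage (continuous_const.update i continuous_id)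
    refine (hasSum_natCast_mul_of_hasSum_mul_pow hline (e := fun m => e m i)
      (A := fun m => A m * ∏ j ∈ univ.erase i, z j ^ e m j) (fun t ht => ?_)
      (by simpa using hz)).congr_fun fun m => ?_
    · refine (hf _ ht).congr_fun fun m => ?_
      rw [prod_update_pow]
      ring
    · rw [← mul_prod_erase univ _ (mem_univ i)]
      ring
  refine (hasSum_sum fun i (_ : i ∈ univ) => hpartial i).congr_fun fun m => ?_
  push_cast
  rw [sum_mul]

end EulerOperator

/-- The function `f` of `n + p` variables is represented on `D` by the power series
`∑ A (m, q) x^m y^q`, as an absolutely convergent sum over all multi-indices. -/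
def HasMonomialExpansion {n p : ℕ} (D : Set ((Fin n → ℂ) × (Fin p → ℂ)))
    (A : (Fin n → ℕ) × (Fin p → ℕ) → ℂ) (f : (Fin n → ℂ) → (Fin p → ℂ) → ℂ) : Prop :=
  ∀ z ∈ D, HasSum (fun mq => A mq * ((∏ i, z.1 i ^ mq.1 i) * ∏ j, z.2 j ^ mq.2 j)) (f z.1 z.2)

namespace HasMonomialExpansion

variable {n p : ℕ} {D : Set ((Fin n → ℂ) × (Fin p → ℂ))} {A : (Fin n → ℕ) × (Fin p → ℕ) → ℂ}
  {f : (Fin n → ℂ) → (Fin p → ℂ) → ℂ}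

theorem apply_eulerX (hD : IsOpen D) (hf : HasMonomialExpansion D A f) :
    HasMonomialExpansion D (fun mq => ((∑ i, mq.1 i : ℕ) : ℂ) * A mq) (eulerX f) := by
  rintro ⟨x, y⟩ hz
  have hU : IsOpen ((fun x => (x, y)) ⁻¹' D) := hD.preimage (by fun_prop)
  have hx : ∀ x ∈ (fun x => (x, y)) ⁻¹' D,
      HasSum (fun mq => A mq * (∏ j, y j ^ mq.2 j) * ∏ i, x i ^ mq.1 i) (f x y) :=
    fun x hx => (hf _ hx).congr_fun fun mq => by ring
  exact (hasSum_sum_mul_deriv_update hU hx hz).congr_fun fun mq => by ring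

theorem apply_eulerY (hD : IsOpen D) (hf : HasMonomialExpansion D A f) :
    HasMonomialExpansion D (fun mq => ((∑ j, mq.2 j : ℕ) : ℂ) * A mq) (eulerY f) := by
  rintro ⟨x, y⟩ hz
  have hU : IsOpen ((fun y => (x, y)) ⁻¹' D) := hD.preimage (by fun_prop)
  have hy : ∀ y ∈ (fun y => (x, y)) ⁻¹' D,
      HasSum (fun mq => A mq * (∏ i, x i ^ mq.1 i) * ∏ j, y j ^ mq.2 j) (f x y) :=
    fun y hy => (hf _ hy).congr_fun fun mq => by ring
  exact (hasSum_sum_mul_deriv_update hU hy hz).congr_fun fun mq => by ring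

theorem neg (hf : HasMonomialExpansion D A f) :
    HasMonomialExpansion D (fun mq => -A mq) (fun x y => -f x y) :=
  fun z hz => (hf z hz).neg.congr_fun fun _ => neg_mul _ _

theorem apply_opPoch {T : ((Fin n → ℂ) → (Fin p → ℂ) → ℂ) → (Fin n → ℂ) → (Fin p → ℂ) → ℂ}
    {ev : (Fin n → ℕ) × (Fin p → ℕ) → ℂ}
    (hT : ∀ {A f}, HasMonomialExpansion D A f →
      HasMonomialExpansion D (fun mq => ev mq * A mq) (T f))
    (hf : HasMonomialExpansion D A f) (k : ℕ) :
    HasMonomialExpansion D (fun mq => poch (ev mq) k * A mq) (opPoch T k f) := by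
  induction k with
  | zero => simpa only [poch_zero, one_mul, opPoch] using hf
  | succ k ih =>
    intro z hz
    have hsum := (hT ih z hz).add ((ih z hz).mul_left (k : ℂ))
    refine hsum.congr_fun fun mq => ?_
    simp only [poch_succ]
    ring

theorem apply_nablaSeriesTerm (hD : IsOpen D) (hf : HasMonomialExpansion D A f) (h : ℂ) (k : ℕ) :
    HasMonomialExpansion D
      (fun mq => poch (-(∑ i, mq.1 i : ℕ)) k * (poch (∑ j, mq.2 j : ℕ) k * A mq) /
        (poch h k * k.factorial)) (nablaSeriesTerm h k f) := by
  have hY : HasMonomialExpansion D (fun mq => poch (∑ j, mq.2 j : ℕ) k * A mq)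
      (opPoch eulerY k f) :=
    hf.apply_opPoch (fun hg => hg.apply_eulerY hD) k
  have hX : HasMonomialExpansion D
      (fun mq => poch (-(∑ i, mq.1 i : ℕ)) k * (poch (∑ j, mq.2 j : ℕ) k * A mq))
      (opPoch (fun g x y => -eulerX g x y) k (opPoch eulerY k f)) :=
    hY.apply_opPoch (fun hg => by simpa only [neg_mul] using (hg.apply_eulerX hD).neg) k
  exact fun z hz => ((hX z hz).div_const _).congr_fun fun mq => by ring

end HasMonomialExpansion

/-! ### The operator `∇̃` applied to `F_A · ₀F_p` -/

theorem lauricellaATerm_mul {n : ℕ} (a : ℂ) (b c u x : Fin n → ℂ) (m : Fin n → ℕ) :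
    lauricellaATerm a b c (u * x) m = lauricellaATerm a b c u m * ∏ i, x i ^ m i := by
  simp only [lauricellaATerm, Pi.mul_apply, mul_pow, mul_assoc, ← prod_mul_distrib]

theorem zeroFTerm_mul {p : ℕ} (d : ℂ) (u y : Fin p → ℂ) (q : Fin p → ℕ) :
    zeroFTerm d (u * y) q = zeroFTerm d u q * ∏ j, y j ^ q j := by
  simp only [zeroFTerm, Pi.mul_apply, mul_pow, mul_assoc, ← prod_mul_distrib, div_mul_eq_mul_div]

theorem lauricellaATerm_mul_zeroFTerm_eq {n p : ℕ} (a : ℂ) (b c : Fin n → ℂ) (d : ℂ)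
    (x : Fin n → ℂ) (y : Fin p → ℂ) (m : Fin n → ℕ) (q : Fin p → ℕ) :
    lauricellaATerm a b c x m * zeroFTerm d (-y) q
      = lauricellaATerm a b c 1 m * zeroFTerm d (-1) q *
        ((∏ i, x i ^ m i) * ∏ j, y j ^ q j) := by
  rw [← one_mul x, lauricellaATerm_mul, one_mul, ← neg_one_mul y, zeroFTerm_mul]
  ring

theorem hasMonomialExpansion_lauricellaA_mul_zeroF {n p : ℕ} (a : ℂ) (b : Fin n → ℂ)
    {c : Fin n → ℂ} (hc : ∀ i, ∀ m : ℕ, c i ≠ -m) {d : ℂ} (hd : ∀ m : ℕ, d ≠ -m) :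
    HasMonomialExpansion {z : (Fin n → ℂ) × (Fin p → ℂ) | ∑ i, ‖z.1 i‖ < 1}
      (fun mq => lauricellaATerm a b c 1 mq.1 * zeroFTerm d (-1) mq.2)
      (fun x y => lauricellaA a b c x * zeroF d (-y)) := by
  rintro ⟨x, y⟩ hx
  have hF := summable_lauricellaATerm a b hc hx
  have hZ := summable_zeroFTerm hd (-y)
  simp only [← lauricellaATerm_mul_zeroFTerm_eq]
  exact hF.hasSum.mul hZ.hasSum (summable_mul_of_summable_norm hF.norm hZ.norm)

theorem poch_neg_natCast (M k : ℕ) : poch (-M) k = (-1) ^ k * M.descFactorial k := by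
  induction k with
  | zero => simp [poch]
  | succ k ih =>
    rw [poch_succ, ih, Nat.descFactorial_succ]
    rcases le_or_gt k M with hk | hk
    · push_cast [hk]
      ring
    · simp [Nat.descFactorial_of_lt hk]

theorem poch_neg_natCast_mul_lauricellaATerm {n : ℕ} (a : ℂ) (b c x : Fin n → ℂ) (m : Fin n → ℕ)
    (k : ℕ) :
    poch (-(∑ i, m i : ℕ)) k * lauricellaATerm a b c x m
      = (-1) ^ k * poch a k * (fwdDiff 1)^[k] (fun z => lauricellaATerm z b c x m) a := by
  rw [poch_neg_natCast, fwdDiff_iter_lauricellaATerm, lauricellaATerm_eq,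
    Nat.descFactorial_eq_factorial_mul_choose]
  rcases lt_or_ge (∑ i, m i) k with hk | hk
  · simp [Nat.choose_eq_zero_of_lt hk]
  · rw [← Nat.add_sub_of_le hk, poch_add, Nat.add_sub_cancel_left]
    push_cast
    ring

theorem nablaSeriesTerm_lauricellaA_mul_zeroF {n p : ℕ} {a : ℂ} (ha : ∀ m : ℤ, a ≠ m)
    (b : Fin n → ℂ) {c x : Fin n → ℂ} (hc : ∀ i, ∀ m : ℕ, c i ≠ -m) (hx : ∑ i, ‖x i‖ < 1)
    (y : Fin p → ℂ) (k : ℕ) :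
    nablaSeriesTerm a k (fun x y => lauricellaA a b c x * zeroF (1 - a) (-y)) x y
      = (-1) ^ k * (fwdDiff 1)^[k] (fun z => lauricellaA z b c x) a *
        ∑' q : Fin p → ℕ, ((∑ j, q j).multichoose k : ℂ) * zeroFTerm (1 - a) (-y) q := by
  have hd : ∀ m : ℕ, 1 - a ≠ -m :=
    one_sub_ne_neg_natCast fun m h => ha (m + 1) (by rw [h]; push_cast; rfl)
  have hpoch : poch a k ≠ 0 := poch_ne_zero (fun m h => ha (-m) (by rw [h]; push_cast; rfl)) k
  have hfact : (k.factorial : ℂ) ≠ 0 := by exact_mod_cast k.factorial_ne_zero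
  have hopen : IsOpen {z : (Fin n → ℂ) × (Fin p → ℂ) | ∑ i, ‖z.1 i‖ < 1} :=
    isOpen_lt (by fun_prop) continuous_const
  have hseries := (hasMonomialExpansion_lauricellaA_mul_zeroF a b hc hd).apply_nablaSeriesTerm
    hopen a k (x, y) hx
  have hdiff : HasSum (fun m => (fwdDiff 1)^[k] (fun z => lauricellaATerm z b c x m) a)
      ((fwdDiff 1)^[k] (fun z => lauricellaA z b c x) a) :=
    hasSum_fwdDiff_iter (fun z => (summable_lauricellaATerm z b hc hx).hasSum) 1 k a
  have hzero := summable_multichoose_mul_zeroFTerm hd (-y) k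
  have hsummable := summable_mul_of_summable_norm hdiff.summable.norm hzero.norm
  have hprod := (hdiff.mul hzero.hasSum hsummable).mul_left ((-1) ^ k)
  rw [mul_assoc]
  refine hseries.unique (hprod.congr_fun fun mq => ?_)
  have hterm := lauricellaATerm_mul_zeroFTerm_eq a b c (1 - a) x y mq.1 mq.2
  have hnewton := poch_neg_natCast_mul_lauricellaATerm a b c x mq.1 k
  simp only [poch_natCast]
  rw [div_mul_eq_mul_div, div_eq_iff (mul_ne_zero hpoch hfact)]
  linear_combination k.factorial * (∑ j, mq.2 j).multichoose k *
    (zeroFTerm (1 - a) (-y) mq.2 * hnewton - poch (-(∑ i, mq.1 i : ℕ)) k * hterm)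

theorem nablaSymbol_mul_poch {a : ℂ} (ha : ∀ m : ℤ, a ≠ m) (M N : ℕ) :
    nablaSymbol a M N * poch a M = poch (a - N) M := by
  have ha0 : ∀ m : ℕ, a ≠ -m := fun m h => ha (-m) (by rw [h]; push_cast; rfl)
  have haN : ∀ m : ℕ, a - N ≠ -m := fun m h => ha (N - m) (by push_cast; linear_combination h)
  have hGamma := Complex.Gamma_ne_zero ha0
  have hGammaM : Complex.Gamma (a + M) ≠ 0 :=
    Complex.Gamma_ne_zero fun m => add_natCast_ne_neg_natCast ha0 M m
  have hGammaN := Complex.Gamma_ne_zero haN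
  rw [nablaSymbol, poch_eq_Gamma a M ha0, poch_eq_Gamma (a - N) M haN, sub_add_eq_add_sub]
  field_simp

theorem nablaSymbol_mul_lauricellaATerm {n : ℕ} {a : ℂ} (ha : ∀ m : ℤ, a ≠ m) (b c x : Fin n → ℂ)
    (m : Fin n → ℕ) (N : ℕ) :
    nablaSymbol a (∑ i, m i) N * lauricellaATerm a b c x m = lauricellaATerm (a - N) b c x m := by
  rw [lauricellaATerm_eq, lauricellaATerm_eq, ← mul_assoc, nablaSymbol_mul_poch ha]

theorem isNablaImage_confluentHA {n p : ℕ} {a : ℂ} (ha : ∀ m : ℤ, a ≠ m) (b : Fin n → ℂ)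
    {c : Fin n → ℂ} (hc : ∀ i, ∀ m : ℕ, c i ≠ -m) :
    IsNablaImage a {z : (Fin n → ℂ) × (Fin p → ℂ) | ∑ i, ‖z.1 i‖ < 1}
      (fun x y => lauricellaA a b c x * zeroF (1 - a) (-y))
      (fun x y => confluentHA a b c x y) := by
  have ha' : ∀ m : ℕ, a ≠ m + 1 := fun m h => ha (m + 1) (by rw [h]; push_cast; rfl)
  have hexp := hasMonomialExpansion_lauricellaA_mul_zeroF (p := p) a b hc
    (one_sub_ne_neg_natCast ha')
  refine ⟨_, fun z hz => ⟨hexp z hz, ?_⟩⟩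
  refine (summable_confluentHATerm ha' b hc hz z.2).hasSum.congr_fun ?_
  rintro ⟨m, q⟩
  have hterm := lauricellaATerm_mul_zeroFTerm_eq a b c (1 - a) z.1 z.2 m q
  rw [confluentHATerm_eq ha', ← nablaSymbol_mul_lauricellaATerm ha]
  linear_combination -nablaSymbol a (∑ i, m i) (∑ j, q j) * hterm

theorem confluentHA_eq_add_tsum_decompTerm {n p : ℕ} {a : ℂ} (ha : ∀ m : ℕ, a ≠ m + 1)
    (b : Fin n → ℂ) {c x : Fin n → ℂ} (hc : ∀ i, ∀ m : ℕ, c i ≠ -m) (hx : ∑ i, ‖x i‖ < 1)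
    (hx' : ∑ i, max (x i).re 0 < 1 / 2) (y : Fin p → ℂ) :
    Summable (fun k : ℕ => decompTerm a b c x y (k + 1)) ∧
    confluentHA a b c x y = lauricellaA a b c x * zeroF (1 - a) (-y) +
      ∑' k : ℕ, decompTerm a b c x y (k + 1) := by
  have hsum := hasSum_confluentHA ha b hc hx hx' y
  simp only [decompTerm_succ ha b hc hx y]
  refine ⟨(summable_nat_add_iff 1).mpr hsum.summable, ?_⟩
  rw [← hsum.tsum_eq, hsum.summable.tsum_eq_zero_add]
  simp [zeroF]

theorem mainTheorem3 (n p : ℕ) (a : ℂ) (b c : Fin n → ℂ)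
    (ha : ∀ m : ℕ, a ≠ m + 1) (hc : ∀ i, ∀ m : ℕ, c i ≠ -m) :
    -- every multiple series that occurs converges absolutely
    (∀ (x : Fin n → ℂ) (y : Fin p → ℂ), ∑ i, ‖x i‖ < 1 →
      Summable (confluentHATerm a b c x y) ∧
      (∀ i : Fin n → ℕ, Summable (lauricellaATerm (a + ∑ s, (i s : ℂ))
        (fun s => b s + i s) (fun s => c s + i s) x)) ∧
      ∀ l : ℕ, Summable (zeroFTerm (1 - a + l) (-y))) ∧
    -- the symbolic identity, for the Gamma quotient of Euler operators
    ((∀ m : ℤ, a ≠ m) →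
      IsNablaImage a {z : (Fin n → ℂ) × (Fin p → ℂ) | ∑ i, ‖z.1 i‖ < 1}
        (fun x y => lauricellaA a b c x * zeroF (1 - a) (-y))
        (fun x y => confluentHA a b c x y)) ∧
    -- the symbolic identity, for the operator series
    ((∀ m : ℤ, a ≠ m) → ∀ (x : Fin n → ℂ) (y : Fin p → ℂ),
      ∑ i, ‖x i‖ < 1 → ∑ i, max (x i).re 0 < 1 / 2 →
      HasSum (fun k : ℕ => nablaSeriesTerm a k
        (fun x y => lauricellaA a b c x * zeroF (1 - a) (-y)) x y) (confluentHA a b c x y)) ∧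
    -- the decomposition formula
    (∀ (x : Fin n → ℂ) (y : Fin p → ℂ),
      ∑ i, ‖x i‖ < 1 → ∑ i, max (x i).re 0 < 1 / 2 →
      Summable (fun k : ℕ => decompTerm a b c x y (k + 1)) ∧
      confluentHA a b c x y = lauricellaA a b c x * zeroF (1 - a) (-y) +
        ∑' k : ℕ, decompTerm a b c x y (k + 1)) ∧
    -- its case of one variable `y`
    (∀ (x : Fin n → ℂ) (y : ℂ),
      ∑ i, ‖x i‖ < 1 → ∑ i, max (x i).re 0 < 1 / 2 →
      (∀ l : ℕ, Summable (zeroF1Term (1 - a + l) (-y))) ∧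
      Summable (fun k : ℕ => decompTermOne a b c x y (k + 1)) ∧
      confluentHA a b c x (fun _ : Fin 1 => y) = lauricellaA a b c x * zeroF1 (1 - a) (-y) +
        ∑' k : ℕ, decompTermOne a b c x y (k + 1)) := by
  have hd := one_sub_ne_neg_natCast ha
  refine ⟨fun x y hx => ⟨summable_confluentHATerm ha b hc hx y,
      fun i => summable_lauricellaATerm _ _ (fun s => add_natCast_ne_neg_natCast (hc s) (i s)) hx,
      fun l => summable_zeroFTerm (add_natCast_ne_neg_natCast hd l) (-y)⟩,
    fun ha' => isNablaImage_confluentHA ha' b hc, fun ha' x y hx hx' => ?_,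
    fun x y hx hx' => confluentHA_eq_add_tsum_decompTerm ha b hc hx hx' y,
    fun x y hx hx' => ⟨fun l => summable_zeroF1Term (add_natCast_ne_neg_natCast hd l) (-y), ?_⟩⟩
  · simp only [nablaSeriesTerm_lauricellaA_mul_zeroF ha' b hc hx]
    exact hasSum_confluentHA ha b hc hx hx' y
  · have hdecomp := confluentHA_eq_add_tsum_decompTerm ha b hc hx hx' fun _ : Fin 1 => y
    rw [show -(fun _ : Fin 1 => y) = fun _ => -y from rfl, zeroF_const] at hdecomp
    simpa only [decompTermOne_eq] using hdecomp
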